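/- Let $S_k$ be the group of permutations of $\{1,\dots,k\}$, where $\sigma\in S_k$ is written in vector notation $[\sigma(1),\dots,\sigma(k)]$ and $\sigma\tau=\sigma\circ\tau$. For $2\le j\le k$ let the push-to-the-top transition $t_{\uparrow j}:S_k\to S_k$ be $$t_{\uparrow j}([a_1,\dots,a_k])=[a_j,a_1,\dots,a_{j-1},a_{j+1},\dots,a_k].$$ A $G^{\mathrm{aux}}_{\uparrow}(k,M)$ is a sequence $C=(c_1,\dots,c_M)$ of $M$ distinct permutations in $S_k$ such that every $c_{r+1}$ ($1\le r<M$), and also $c_1$ with $c_M$ as its predecessor, is obtained from its predecessor by some transition $t_{\uparrow j}$ with $2\le j\le k$, and such that for all $q\in\{1,\dots,k-1\}$ and all $\sigma\in C$ we have $(q,k)\circ\sigma\notin C$, where $(q,k)$ is the transposition of $q$ and $k$. **Theorem.** Let $k\ge 6$ be even. Then there exists a $G^{\mathrm{aux}}_{\uparrow}(k,M)$ with $c_1=\mathrm{id}$ and $c_2=t_{\uparrow k}(\mathrm{id})$, where $$M=\begin{cases}178,& k=6,\\ (k-3)\left(\frac{(k-1)!}{2}+2\right)+1,& k>6.\end{cases}$$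 In particular, for all even $k>6$, $$M>\frac{k-3}{k}\cdot\frac{k!}{2}.$$ -/

import Mathlib

open Equiv

/-- The "push-to-the-`i`th-index" transition on the `j`th index (meant for `i < j`), acting on
the vector notation `[σ 0, σ 1, …, σ (n-1)]` of a permutation `σ` of `Fin n`: the entry at
index `j` is moved to index `i`, and the entries at indices `i, …, j - 1` move one place to the
right. It is right multiplication by the cycle `(j, j-1, …, i)`. -/
def pushToIndex {n : ℕ} (i j : Fin n) (σ : Perm (Fin n)) : Perm (Fin n) :=
  σ * (Fin.cycleIcc i j)⁻¹

theorem pushToIndex_apply_target {n : ℕ} [NeZero n] {i j : Fin n} (hij : i ≤ j)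
    (σ : Perm (Fin n)) : pushToIndex i j σ i = σ j := by
  have h : (Fin.cycleIcc i j)⁻¹ i = j := by
    rw [Perm.inv_eq_iff_eq, Fin.cycleIcc_of_last hij]
  rw [pushToIndex, Perm.mul_apply, h]

theorem pushToIndex_apply_between {n : ℕ} [NeZero n] {i j p : Fin n} (hip : i ≤ p) (hpj : p < j)
    (σ : Perm (Fin n)) : pushToIndex i j σ (p + 1) = σ p := by
  have h : (Fin.cycleIcc i j)⁻¹ (p + 1) = p := by
    rw [Perm.inv_eq_iff_eq, Fin.cycleIcc_of_ge_of_lt hip hpj]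
  rw [pushToIndex, Perm.mul_apply, h]

theorem pushToIndex_apply_outside {n : ℕ} {i j p : Fin n} (hp : p < i ∨ j < p)
    (σ : Perm (Fin n)) : pushToIndex i j σ p = σ p := by
  have h : (Fin.cycleIcc i j)⁻¹ p = p := by
    rw [Perm.inv_eq_iff_eq]
    rcases hp with hp | hp
    · rw [Fin.cycleIcc_of_lt hp]
    · rw [Fin.cycleIcc_of_gt hp]
  rw [pushToIndex, Perm.mul_apply, h]

/-- The "push-to-the-top" transition on index `j`. -/
def pushToTop {n : ℕ} [NeZero n] (j : Fin n) : Perm (Fin n) → Perm (Fin n) :=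
  pushToIndex 0 j

/-- A `T`-Gray code of size `M` over `S`: a sequence of `M` distinct elements of `S`, each of
which is obtained from its predecessor by a transition in `T`. -/
structure IsGrayCode {S : Type*} (T : Set (S → S)) {M : ℕ} (c : Fin M → S) : Prop where
  injective : Function.Injective c
  step : ∀ (r : ℕ) (h : r + 1 < M), ∃ t ∈ T, c ⟨r + 1, h⟩ = t (c ⟨r, Nat.lt_of_succ_lt h⟩)

/-- A cyclic `T`-Gray code: moreover its first element is obtained from its last one by a
transition in `T`. -/
structure IsCyclicGrayCode {S : Type*} (T : Set (S → S)) {M : ℕ} (c : Fin M → S) : Prop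
    extends IsGrayCode T c where
  cyclic : ∃ (h : 0 < M), ∃ t ∈ T, c ⟨0, h⟩ = t (c ⟨M - 1, Nat.sub_one_lt_of_lt h⟩)

/-- A "push-to-the-`i`th-index" code of size `M` in the symmetric group on `n` letters. -/
def IsPushToIndexCode {n M : ℕ} (i : Fin n) (c : Fin M → Perm (Fin n)) : Prop :=
  IsCyclicGrayCode {t | ∃ j : Fin n, i < j ∧ t = pushToIndex i j} c

/-- A "push-to-the-top" code of size `M` in the symmetric group on `n` letters. -/
def IsPushToTopCode {n M : ℕ} [NeZero n] (c : Fin M → Perm (Fin n)) : Prop :=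
  IsPushToIndexCode 0 c

/-- An auxiliary "push-to-the-top" code of size `M` in the symmetric group on `k` letters: it
never contains both `σ` and `(q, k) ∘ σ`, where `q` is a letter other than the last letter `k`
(which is `⊤ : Fin k`). -/
structure IsAuxCode {k M : ℕ} [NeZero k] (c : Fin M → Perm (Fin k)) : Prop where
  pushToTop : IsPushToTopCode c
  aux : ∀ q : Fin k, q < ⊤ → ∀ σ ∈ Set.range c, swap q ⊤ * σ ∉ Set.range c

/-- The sequence `c` starts at `x`, and its first transition is `t`. -/
def StartsWith {S : Type*} {M : ℕ} (c : Fin M → S) (x : S) (t : S → S) : Prop :=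
  ∃ h : 1 < M, c ⟨0, Nat.zero_lt_of_lt h⟩ = x ∧ c ⟨1, h⟩ = t x

/-
Number letters and positions from `0` and put `n = k - 1`, which is odd. Pushing the index `j` to
the top is right multiplication by a cycle `top n j`. The cosets of the powers of
`S = top n (n - 1)`, which has order `n`, are called rings. With the 3-cycle `Q = rot3 n (n - 3)`
one has `top n (n - 3) = Q * S`, so a step `u → u * S` can be replaced by a detour which runs
through the whole rings of `u * Q` and `u * Q ^ 2`. Hence a path can be extended by every set of
rings which grows out of it along hyperedges that consist of the rings of `u`, `u * Q`, `u * Q ^ 2`.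

Let `n ≥ 7`. The permutations with a given last letter and a given sign form a class, and `x` and
`x * S` belong to the same class. Represent a ring by its element with a fixed letter at the index
`n - 1`. As `S` conjugates the 3-cycles of adjacent positions to one another, those of the first
`n - 1` positions give hyperedges. By induction on the number of moving letters, the rearrangements
of a given sign, except for any one of them, can be added two at a time. Leaving out the
representatives with the entry of `x * S` at the index `n - 2`, which include that of the ring of
`x` itself, one gets a path from `x` to `x * S` in the class of `x` which misses one prescribed
further ring. That ring is chosen such that no `(q, n) ∘ σ` is `1` or the inverse of `S`.

The transitions `top n n` link `n` classes with the last letters other than `n`, each with one sign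
only, so `(q, n) ∘ σ` never leads from these classes back into them. The cycle is closed through
the inverse of `S` and `1`. The size that is asked for is reached by giving one class a short path
of `2 * n - 3` elements and taking two rings less in another one.

For `n = 5` there is an explicit code.
-/

namespace PushCode

open Finset

section Hypertree

variable {V W : Type*} [DecidableEq V] [DecidableEq W] {E : V → V → V → Prop}

/-- A step of growth in a 3-uniform hypergraph with hyperedges `E`: a hyperedge with exactly one
vertex in `A` adds its two other vertices. -/
def GrowStep (E : V → V → V → Prop) (A B : Finset V) : Prop :=
  ∃ a b c, E a b c ∧ a ∈ A ∧ b ∉ A ∧ c ∉ A ∧ b ≠ c ∧ B = insert b (insert c A)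

/-- `B` is obtained from `A` by successive growth steps. -/
def Grows (E : V → V → V → Prop) : Finset V → Finset V → Prop :=
  Relation.ReflTransGen (GrowStep E)

/-- The vertex set of a subtree of a 3-uniform hypergraph, encoded as a set that grows from each of
its vertices. The empty set is allowed. -/
def IsHypertree (E : V → V → V → Prop) (S : Finset V) : Prop :=
  ∀ v ∈ S, Grows E {v} S

theorem Grows.union_right {A B D : Finset V} (h : Grows E A B) (hD : Disjoint B D) :
    Grows E (A ∪ D) (B ∪ D) := by
  induction h with
  | refl => exact .refl
  | @tail B C _ hstep ih =>
    obtain ⟨a, b, c, hE, ha, hb, hc, hbc, rfl⟩ := hstep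
    simp only [disjoint_insert_left] at hD
    exact (ih hD.2.2).tail ⟨a, b, c, hE, by simp [ha], by simp [hb, hD.1], by simp [hc, hD.2.1],
      hbc, by simp only [insert_union]⟩

theorem Grows.image {A B : Finset V} {F : W → W → W → Prop} {f : V → W} (h : Grows E A B)
    (hf : Set.InjOn f B) (hE : ∀ a b c, E a b c → F (f a) (f b) (f c)) :
    Grows F (A.image f) (B.image f) := by
  induction h with
  | refl => exact .refl
  | @tail B C _ hstep ih =>
    obtain ⟨a, b, c, habc, ha, hb, hc, hbc, rfl⟩ := hstep
    have hsub : B ⊆ insert b (insert c B) := (subset_insert c B).trans (subset_insert b _)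
    have notMem {x : V} (hx : x = b ∨ x = c) (hxB : x ∉ B) : f x ∉ B.image f := by
      rintro hfx
      obtain ⟨y, hy, hyx⟩ := mem_image.1 hfx
      have : y = x := hf (by simp [hy]) (by rcases hx with rfl | rfl <;> simp) hyx
      exact hxB (this ▸ hy)
    refine (ih (hf.mono (coe_subset.2 hsub))).tail ⟨f a, f b, f c, hE _ _ _ habc,
      mem_image_of_mem f ha, notMem (.inl rfl) hb, notMem (.inr rfl) hc,
      fun e => hbc (hf (by simp) (by simp) e), ?_⟩
    simp only [image_insert]

theorem isHypertree_singleton (v : V) : IsHypertree E {v} := by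
  intro w hw
  rw [mem_singleton.1 hw]
  exact .refl

theorem IsHypertree.grows_join {S₁ S₂ S₃ : Finset V} (h₁ : IsHypertree E S₁)
    (h₂ : IsHypertree E S₂) (h₃ : IsHypertree E S₃) (h₁₂ : Disjoint S₁ S₂) (h₁₃ : Disjoint S₁ S₃)
    (h₂₃ : Disjoint S₂ S₃) {v₁ v₂ v₃ : V} (m₁ : v₁ ∈ S₁) (m₂ : v₂ ∈ S₂) (m₃ : v₃ ∈ S₃)
    (hE : E v₁ v₂ v₃) {v : V} (hv : v ∈ S₁) : Grows E {v} (S₁ ∪ S₂ ∪ S₃) := by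
  have n₂ : v₂ ∉ S₁ := disjoint_right.1 h₁₂ m₂
  have n₃ : v₃ ∉ S₁ := disjoint_right.1 h₁₃ m₃
  have n₃₂ : v₃ ∉ S₂ := disjoint_right.1 h₂₃ m₃
  have addEdge : Grows E {v} ({v₂} ∪ ({v₃} ∪ S₁)) :=
    (h₁ v hv).tail ⟨v₁, v₂, v₃, hE, m₁, n₂, n₃, fun e => n₃₂ (e ▸ m₂), rfl⟩
  have growS₂ : Grows E ({v₂} ∪ ({v₃} ∪ S₁)) (S₂ ∪ ({v₃} ∪ S₁)) :=
    (h₂ v₂ m₂).union_right (by simp [n₃₂, h₁₂.symm])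
  have growS₃ : Grows E ({v₃} ∪ (S₂ ∪ S₁)) (S₃ ∪ (S₂ ∪ S₁)) :=
    (h₃ v₃ m₃).union_right (by simp [disjoint_union_right, h₂₃.symm, h₁₃.symm])
  rw [union_left_comm] at growS₃
  rw [union_comm, union_comm S₁]
  exact (addEdge.trans growS₂).trans growS₃

theorem IsHypertree.join (hcyc : ∀ a b c, E a b c → E b c a) {S₁ S₂ S₃ : Finset V}
    (h₁ : IsHypertree E S₁) (h₂ : IsHypertree E S₂) (h₃ : IsHypertree E S₃)
    (h₁₂ : Disjoint S₁ S₂) (h₁₃ : Disjoint S₁ S₃) (h₂₃ : Disjoint S₂ S₃) {v₁ v₂ v₃ : V}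
    (m₁ : v₁ ∈ S₁) (m₂ : v₂ ∈ S₂) (m₃ : v₃ ∈ S₃) (hE : E v₁ v₂ v₃) :
    IsHypertree E (S₁ ∪ S₂ ∪ S₃) := by
  intro v hv
  simp only [mem_union] at hv
  rcases hv with (hv | hv) | hv
  · exact h₁.grows_join h₂ h₃ h₁₂ h₁₃ h₂₃ m₁ m₂ m₃ hE hv
  · rw [union_assoc, union_comm]
    exact h₂.grows_join h₃ h₁ h₂₃ h₁₂.symm h₁₃.symm m₂ m₃ m₁ (hcyc _ _ _ hE) hv
  · rw [union_comm, ← union_assoc]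
    exact h₃.grows_join h₁ h₂ h₁₃.symm h₂₃.symm h₁₂ m₃ m₁ m₂ (hcyc _ _ _ (hcyc _ _ _ hE)) hv

theorem IsHypertree.join_erase (hcyc : ∀ a b c, E a b c → E b c a) {S A B : Finset V}
    {e f a a' b b' : V} (hS : IsHypertree E S) (hA : IsHypertree E (A.erase a'))
    (hB : IsHypertree E (B.erase b')) (hSA : Disjoint S A) (hSB : Disjoint S B)
    (hAB : Disjoint A B) (he : e ∈ S) (ha : a ∈ A) (haa' : a ≠ a') (hb : b ∈ B) (hbb' : b ≠ b')
    (heab : E e a b) (hf : f ∈ S) (ha' : a' ∈ A) (hb' : b' ∈ B) (hfba : E f b' a') :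
    IsHypertree E (S ∪ A ∪ B) := by
  have hab' : a' ∉ B := disjoint_left.1 hAB ha'
  have hba' : b' ∉ A := disjoint_right.1 hAB hb'
  have joinErased : IsHypertree E (S ∪ A.erase a' ∪ B.erase b') :=
    hS.join hcyc hA hB (hSA.mono_right (erase_subset _ _)) (hSB.mono_right (erase_subset _ _))
      (hAB.mono (erase_subset _ _) (erase_subset _ _)) he (mem_erase.2 ⟨haa', ha⟩)
      (mem_erase.2 ⟨hbb', hb⟩) heab
  have joinAll : IsHypertree E (S ∪ A.erase a' ∪ B.erase b' ∪ {b'} ∪ {a'}) := by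
    refine joinErased.join hcyc (isHypertree_singleton b') (isHypertree_singleton a') ?_ ?_ ?_
      (mem_union_left _ (mem_union_left _ hf)) (mem_singleton_self _) (mem_singleton_self _) hfba
    · simp [disjoint_right.1 hSB hb', hba']
    · simp [disjoint_right.1 hSA ha', hab']
    · exact disjoint_singleton.2 fun e => hab' (e ▸ hb')
  convert joinAll using 1
  rw [← insert_erase ha', ← insert_erase hb']
  ext x
  simp only [mem_union, mem_insert, mem_singleton, mem_erase]
  tauto

theorem Grows.exists_last {v : V} {S : Finset V} (h : Grows E {v} S) (hS : 1 < #S) :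
    ∃ S', Grows E {v} S' ∧ S' ⊆ S ∧ #S' + 2 = #S := by
  rcases Relation.ReflTransGen.cases_tail h with rfl | ⟨S', h', a, b, c, -, -, hb, hc, hbc, rfl⟩
  · simp at hS
  · refine ⟨S', h', (subset_insert c S').trans (subset_insert b _), ?_⟩
    rw [card_insert_of_notMem (by simp [hb, hbc]), card_insert_of_notMem hc]

end Hypertree

theorem perm_apply_inv_self {α : Type*} (g : Perm α) (z : α) : g (g⁻¹ z) = z :=
  g.apply_symm_apply z

theorem perm_inv_apply_self {α : Type*} (g : Perm α) (z : α) : g⁻¹ (g z) = z :=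
  g.symm_apply_apply z

/-- The position with index `j` in the vector notation of a permutation of `Fin (n + 1)`, meant for
`j ≤ n`. -/
def pos (n j : ℕ) : Fin (n + 1) := Fin.ofNat (n + 1) j

theorem pos_val {n j : ℕ} (h : j ≤ n) : (pos n j).val = j :=
  Nat.mod_eq_of_lt (Nat.lt_succ_of_le h)

theorem pos_val_self {n : ℕ} (p : Fin (n + 1)) : pos n p.val = p :=
  Fin.ext (pos_val (Nat.le_of_lt_succ p.isLt))

theorem pos_ne {n i j : ℕ} (hi : i ≤ n) (hj : j ≤ n) (h : i ≠ j) : pos n i ≠ pos n j := fun e =>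
  h (by rw [← pos_val hi, ← pos_val hj, e])

theorem ne_pos {n j : ℕ} {p : Fin (n + 1)} (hj : j ≤ n) (h : p.val ≠ j) : p ≠ pos n j := fun e =>
  h (by rw [e, pos_val hj])

theorem apply_pos_ne {n i j : ℕ} (σ : Perm (Fin (n + 1))) (hi : i ≤ n) (hj : j ≤ n) (h : i ≠ j) :
    σ (pos n i) ≠ σ (pos n j) :=
  σ.injective.ne (pos_ne hi hj h)

/-- The 3-cycle of positions whose right action turns the entries `x, y, z` at the indices
`j, j + 1, j + 2` into `y, z, x`. -/
def rot3 (n j : ℕ) : Perm (Fin (n + 1)) :=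
  swap (pos n j) (pos n (j + 1)) * swap (pos n (j + 1)) (pos n (j + 2))

section rot3

variable {n j : ℕ}

theorem rot3_apply_zero (h : j + 2 ≤ n) : rot3 n j (pos n j) = pos n (j + 1) := by
  rw [rot3, Perm.mul_apply, swap_apply_of_ne_of_ne (a := pos n (j + 1)), swap_apply_left]
  all_goals exact pos_ne (by lia) (by lia) (by lia)

theorem rot3_apply_one (h : j + 2 ≤ n) : rot3 n j (pos n (j + 1)) = pos n (j + 2) := by
  rw [rot3, Perm.mul_apply, swap_apply_left, swap_apply_of_ne_of_ne]
  all_goals exact pos_ne (by lia) (by lia) (by lia)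

theorem rot3_apply_two : rot3 n j (pos n (j + 2)) = pos n j := by
  rw [rot3, Perm.mul_apply, swap_apply_right, swap_apply_right]

theorem rot3_apply_of_ne (h : j + 2 ≤ n) {p : Fin (n + 1)} (h₀ : p.val ≠ j)
    (h₁ : p.val ≠ j + 1) (h₂ : p.val ≠ j + 2) : rot3 n j p = p := by
  rw [rot3, Perm.mul_apply, swap_apply_of_ne_of_ne (a := pos n (j + 1)),
    swap_apply_of_ne_of_ne]
  all_goals exact ne_pos (by lia) (by lia)

theorem rot3_apply_pos_of_ne (h : j + 2 ≤ n) {i : ℕ} (hi : i ≤ n) (h₀ : i ≠ j)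
    (h₁ : i ≠ j + 1) (h₂ : i ≠ j + 2) : rot3 n j (pos n i) = pos n i :=
  rot3_apply_of_ne h (by rwa [pos_val hi]) (by rwa [pos_val hi]) (by rwa [pos_val hi])

theorem rot3_val (h : j + 2 ≤ n) (p : Fin (n + 1)) :
    (rot3 n j p).val = if p.val = j then j + 1 else if p.val = j + 1 then j + 2
      else if p.val = j + 2 then j else p.val := by
  split_ifs with h₀ h₁ h₂
  · rw [← pos_val_self p, h₀, rot3_apply_zero h, pos_val (by lia)]
  · rw [← pos_val_self p, h₁, rot3_apply_one h, pos_val (by lia)]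
  · rw [← pos_val_self p, h₂, rot3_apply_two, pos_val (by lia)]
  · rw [rot3_apply_of_ne h h₀ h₁ h₂]

theorem sign_rot3 (h : j + 2 ≤ n) : Perm.sign (rot3 n j) = 1 := by
  rw [rot3, Perm.sign_mul, Perm.sign_swap (pos_ne (by lia) (by lia) (by lia)),
    Perm.sign_swap (pos_ne (by lia) (by lia) (by lia)), Int.units_mul_self]

theorem rot3_mul_rot3_mul_rot3 (h : j + 2 ≤ n) : rot3 n j * rot3 n j * rot3 n j = 1 := by
  ext p
  simp only [Perm.mul_apply, Perm.one_apply, rot3_val h]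
  split_ifs <;> lia

theorem mul_rot3_apply_zero (h : j + 2 ≤ n) (σ : Perm (Fin (n + 1))) :
    (σ * rot3 n j) (pos n j) = σ (pos n (j + 1)) := by
  rw [Perm.mul_apply, rot3_apply_zero h]

theorem mul_rot3_apply_one (h : j + 2 ≤ n) (σ : Perm (Fin (n + 1))) :
    (σ * rot3 n j) (pos n (j + 1)) = σ (pos n (j + 2)) := by
  rw [Perm.mul_apply, rot3_apply_one h]

theorem mul_rot3_apply_two (σ : Perm (Fin (n + 1))) :
    (σ * rot3 n j) (pos n (j + 2)) = σ (pos n j) := by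
  rw [Perm.mul_apply, rot3_apply_two]

theorem mul_rot3_apply_of_ne (h : j + 2 ≤ n) {i : ℕ} (hi : i ≤ n) (h₀ : i ≠ j) (h₁ : i ≠ j + 1)
    (h₂ : i ≠ j + 2) (σ : Perm (Fin (n + 1))) : (σ * rot3 n j) (pos n i) = σ (pos n i) := by
  rw [Perm.mul_apply, rot3_apply_pos_of_ne h hi h₀ h₁ h₂]

theorem mul_rot3_mul_rot3_apply_zero (h : j + 2 ≤ n) (σ : Perm (Fin (n + 1))) :
    (σ * rot3 n j * rot3 n j) (pos n j) = σ (pos n (j + 2)) := by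
  rw [mul_rot3_apply_zero h, mul_rot3_apply_one h]

theorem mul_rot3_mul_rot3_apply_two (h : j + 2 ≤ n) (σ : Perm (Fin (n + 1))) :
    (σ * rot3 n j * rot3 n j) (pos n (j + 2)) = σ (pos n (j + 1)) := by
  rw [mul_rot3_apply_two, mul_rot3_apply_zero h]

theorem mul_rot3_ne_self (h : j + 2 ≤ n) (σ : Perm (Fin (n + 1))) : σ * rot3 n j ≠ σ := fun e =>
  apply_pos_ne σ (by lia) (by lia) (Nat.succ_ne_self j) (by rw [← mul_rot3_apply_zero h, e])

theorem mul_rot3_mul_rot3_ne_self (h : j + 2 ≤ n) (σ : Perm (Fin (n + 1))) :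
    σ * rot3 n j * rot3 n j ≠ σ := fun e =>
  mul_rot3_ne_self h σ (by
    conv_lhs => rw [← e]
    rw [mul_assoc, mul_assoc, ← mul_assoc (rot3 n j), rot3_mul_rot3_mul_rot3 h, mul_one])

end rot3

/-- The hyperedges `{a, aQ, aQ²}`, where `Q` rotates three consecutive entries among the first
`n`. -/
def RotEdge (n : ℕ) (a b c : Perm (Fin (n + 1))) : Prop :=
  ∃ j, j + 2 < n ∧ b = a * rot3 n j ∧ c = a * rot3 n j * rot3 n j

theorem rotEdge_mul_rot3 {n j : ℕ} (hj : j + 2 < n) (a : Perm (Fin (n + 1))) :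
    RotEdge n a (a * rot3 n j) (a * rot3 n j * rot3 n j) :=
  ⟨j, hj, rfl, rfl⟩

theorem RotEdge.cyclic {n : ℕ} (a b c : Perm (Fin (n + 1))) (h : RotEdge n a b c) :
    RotEdge n b c a := by
  obtain ⟨j, hj, rfl, rfl⟩ := h
  refine ⟨j, hj, rfl, ?_⟩
  rw [mul_assoc, mul_assoc, ← mul_assoc (rot3 n j), rot3_mul_rot3_mul_rot3 hj.le, mul_one]

/-- The arrangements of the first `N` entries: the permutations that agree with `g` from index `N`
on and have the same sign as `g`. -/
def tailCoset (n N : ℕ) (g : Perm (Fin (n + 1))) : Finset (Perm (Fin (n + 1))) :=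
  {σ | (∀ p : Fin (n + 1), N ≤ p.val → σ p = g p) ∧ Perm.sign σ = Perm.sign g}

section tailCoset

variable {n N : ℕ} {g h : Perm (Fin (n + 1))}

theorem mem_tailCoset {σ : Perm (Fin (n + 1))} : σ ∈ tailCoset n N g ↔
    (∀ p, N ≤ p.val → σ p = g p) ∧ Perm.sign σ = Perm.sign g := by
  simp [tailCoset]

theorem self_mem_tailCoset : g ∈ tailCoset n N g := mem_tailCoset.2 ⟨fun _ _ => rfl, rfl⟩

theorem mul_rot3_mem_tailCoset (hh : h ∈ tailCoset n N g) {j : ℕ} (hj : j + 2 < N)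
    (hN : N ≤ n + 1) : h * rot3 n j ∈ tailCoset n N g := by
  obtain ⟨hval, hsign⟩ := mem_tailCoset.1 hh
  refine mem_tailCoset.2 ⟨fun p hp => ?_, ?_⟩
  · rw [Perm.mul_apply, rot3_apply_of_ne (by lia) (by lia) (by lia) (by lia), hval p hp]
  · rw [Perm.sign_mul, sign_rot3 (by lia), mul_one, hsign]

/-- The letters at the indices `0, …, N` of `g`, which are the possible entries at index `N` of the
members of `tailCoset n (N + 1) g`. -/
def headLetters (n N : ℕ) (g : Perm (Fin (n + 1))) : Finset (Fin (n + 1)) :=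
  {z | (g⁻¹ z).val ≤ N}

theorem mem_headLetters {z : Fin (n + 1)} : z ∈ headLetters n N g ↔ (g⁻¹ z).val ≤ N := by
  simp [headLetters]

theorem card_headLetters (hN : N ≤ n) : #(headLetters n N g) = N + 1 := by
  have : headLetters n N g = (Iic (pos n N)).map g.toEmbedding := by
    ext z
    simp only [mem_headLetters, mem_map_equiv, mem_Iic, Fin.le_def, pos_val hN]
    rfl
  rw [this, card_map, Fin.card_Iic, pos_val hN]

theorem apply_mem_headLetters (hh : ∀ p : Fin (n + 1), N < p.val → h p = g p)
    {p : Fin (n + 1)} : h p ∈ headLetters n N g ↔ p.val ≤ N := by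
  rw [mem_headLetters, ← not_lt, ← not_lt, not_iff_not]
  refine ⟨fun hlt => ?_, fun hp => by rwa [hh p hp, perm_inv_apply_self]⟩
  have hp : h (g⁻¹ (h p)) = h p := by rw [hh _ hlt, perm_apply_inv_self]
  rwa [h.injective hp] at hlt

theorem apply_pos_mem_headLetters (hN : N ≤ n) (hh : h ∈ tailCoset n (N + 1) g) :
    h (pos n N) ∈ headLetters n N g :=
  (apply_mem_headLetters (mem_tailCoset.1 hh).1).2 (pos_val hN).le

theorem exists_agree_apply_eq {σ : Perm (Fin (n + 1))} {q : ℕ} {y : Fin (n + 1)} (hN : N ≤ n)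
    (hq : q ≤ N) (hσ : ∀ p : Fin (n + 1), N < p.val → σ p = g p) (hy : y ∈ headLetters n N g) :
    ∃ σ' : Perm (Fin (n + 1)), (∀ p : Fin (n + 1), N < p.val → σ' p = g p) ∧
      σ' (pos n q) = y ∧ ∀ r, r ≠ pos n q → σ r ≠ y → σ' r = σ r := by
  have hy' : (σ⁻¹ y).val ≤ N := by
    rw [← apply_mem_headLetters hσ, perm_apply_inv_self]
    exact hy
  refine ⟨σ * swap (σ⁻¹ y) (pos n q), fun p hp => ?_, ?_, fun r hr hry => ?_⟩
  · rw [Perm.mul_apply, swap_apply_of_ne_of_ne (fun e => by rw [e] at hp; lia)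
      (ne_pos (by lia) (by lia)), hσ p hp]
  · rw [Perm.mul_apply, swap_apply_right, perm_apply_inv_self]
  · rw [Perm.mul_apply, swap_apply_of_ne_of_ne (fun e => hry (by rw [e, perm_apply_inv_self])) hr]

theorem exists_mem_tailCoset_agree {σ : Perm (Fin (n + 1))} (h2 : 2 ≤ N) (hN : N ≤ n + 1)
    (hσ : ∀ p : Fin (n + 1), N ≤ p.val → σ p = g p) :
    ∃ e ∈ tailCoset n N g, ∀ p : Fin (n + 1), 2 ≤ p.val → e p = σ p := by
  by_cases hs : Perm.sign σ = Perm.sign g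
  · exact ⟨σ, mem_tailCoset.2 ⟨hσ, hs⟩, fun _ _ => rfl⟩
  · have fix : ∀ p : Fin (n + 1), 2 ≤ p.val → (σ * swap (pos n 0) (pos n 1)) p = σ p :=
      fun p hp => by
        rw [Perm.mul_apply, swap_apply_of_ne_of_ne (ne_pos (by lia) (by lia))
          (ne_pos (by lia) (by lia))]
    refine ⟨_, mem_tailCoset.2 ⟨fun p hp => (fix p (h2.trans hp)).trans (hσ p hp), ?_⟩, fix⟩
    rw [Perm.sign_mul, Perm.sign_swap (pos_ne (by lia) (by lia) (by lia)), mul_neg, mul_one,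
      Int.units_ne_iff_eq_neg.1 hs, neg_neg]

theorem exists_mem_tailCoset_apply_eq (h2 : 2 ≤ N) (hN : N ≤ n) {z : Fin (n + 1)}
    (hz : z ∈ headLetters n N g) : ∃ e ∈ tailCoset n (N + 1) g, e (pos n N) = z := by
  obtain ⟨σ, hσ, hσz, -⟩ := exists_agree_apply_eq hN le_rfl (fun _ _ => rfl) hz
  obtain ⟨e, he, heσ⟩ := exists_mem_tailCoset_agree (N := N + 1) (by lia) (by lia) hσ
  exact ⟨e, he, by rw [heσ _ (by rwa [pos_val hN]), hσz]⟩

theorem exists_mem_tailCoset_apply_eq₃ {M : ℕ} (h2 : 2 ≤ M) (hM : M + 2 ≤ n) {a b z : Fin (n + 1)}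
    (ha : a ∈ headLetters n (M + 2) g) (hb : b ∈ headLetters n (M + 2) g)
    (hz : z ∈ headLetters n (M + 2) g) (hab : a ≠ b) (haz : a ≠ z) (hbz : b ≠ z) :
    ∃ e ∈ tailCoset n (M + 3) g,
      e (pos n M) = a ∧ e (pos n (M + 1)) = b ∧ e (pos n (M + 2)) = z := by
  obtain ⟨σ₁, t₁, z₁, -⟩ := exists_agree_apply_eq hM le_rfl (fun _ _ => rfl) hz
  obtain ⟨σ₂, t₂, b₂, agree₂⟩ := exists_agree_apply_eq (q := M + 1) hM (by lia) t₁ hb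
  obtain ⟨σ₃, t₃, a₃, agree₃⟩ := exists_agree_apply_eq (q := M) hM (by lia) t₂ ha
  have z₂ : σ₂ (pos n (M + 2)) = z := by
    rw [agree₂ _ (pos_ne hM (by lia) (by lia)) (by rw [z₁]; exact hbz.symm), z₁]
  have z₃ : σ₃ (pos n (M + 2)) = z := by
    rw [agree₃ _ (pos_ne hM (by lia) (by lia)) (by rw [z₂]; exact haz.symm), z₂]
  have b₃ : σ₃ (pos n (M + 1)) = b := by
    rw [agree₃ _ (pos_ne (by lia) (by lia) (by lia)) (by rw [b₂]; exact hab.symm), b₂]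
  obtain ⟨e, he, heσ⟩ := exists_mem_tailCoset_agree (N := M + 3) (by lia) (by lia) t₃
  refine ⟨e, he, ?_, ?_, ?_⟩
  · rw [heσ _ (by rw [pos_val (by lia)]; lia), a₃]
  · rw [heσ _ (by rw [pos_val (by lia)]; lia), b₃]
  · rw [heσ _ (by rw [pos_val (by lia)]; lia), z₃]

theorem eq_one_of_card_support_le_two {α : Type*} [DecidableEq α] [Fintype α] {τ : Perm α}
    (hcard : #τ.support ≤ 2) (hsign : Perm.sign τ = 1) : τ = 1 := by
  rcases hcard.lt_or_eq with hlt | heq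
  · exact Perm.card_support_le_one.1 (Nat.lt_succ_iff.1 hlt)
  · rw [(Perm.card_support_eq_two.1 heq).sign_eq] at hsign
    exact absurd hsign (by decide)

theorem tailCoset_two (g : Perm (Fin (n + 1))) : tailCoset n 2 g = {g} := by
  ext σ
  rw [mem_tailCoset, mem_singleton]
  refine ⟨fun ⟨hval, hsign⟩ => ?_, fun e => by simp [e]⟩
  have hsupport : (g⁻¹ * σ).support ⊆ {pos n 0, pos n 1} := fun p hp => by
    have hp2 : p.val < 2 := by
      by_contra! hle
      exact Perm.mem_support.1 hp (by rw [Perm.mul_apply, hval p hle, perm_inv_apply_self])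
    rw [mem_insert, mem_singleton, ← pos_val_self p]
    rcases (by lia : p.val = 0 ∨ p.val = 1) with h | h <;> simp [h]
  have hone := eq_one_of_card_support_le_two ((card_le_card hsupport).trans card_le_two)
    (by rw [Perm.sign_mul, Perm.sign_inv, hsign, Int.units_mul_self])
  exact (inv_mul_eq_one.1 hone).symm

/-- The members of `tailCoset n (N + 1) g` whose last free entry, the one at index `N`, is in
`Z`. -/
def lettersPart (n N : ℕ) (g : Perm (Fin (n + 1))) (Z : Finset (Fin (n + 1))) :
    Finset (Perm (Fin (n + 1))) :=
  {σ ∈ tailCoset n (N + 1) g | σ (pos n N) ∈ Z}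

theorem mem_lettersPart {Z : Finset (Fin (n + 1))} {σ : Perm (Fin (n + 1))} :
    σ ∈ lettersPart n N g Z ↔ σ ∈ tailCoset n (N + 1) g ∧ σ (pos n N) ∈ Z := by
  simp [lettersPart]

theorem lettersPart_headLetters (hN : N ≤ n) :
    lettersPart n N g (headLetters n N g) = tailCoset n (N + 1) g :=
  filter_true_of_mem fun _ hσ => apply_pos_mem_headLetters hN hσ

theorem lettersPart_singleton (hN : N ≤ n) (hh : h ∈ tailCoset n (N + 1) g) :
    lettersPart n N g {h (pos n N)} = tailCoset n N h := by
  obtain ⟨hval, hsign⟩ := mem_tailCoset.1 hh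
  ext σ
  simp only [mem_lettersPart, mem_singleton, mem_tailCoset, hsign]
  constructor
  · rintro ⟨⟨hσ, hσs⟩, hσN⟩
    refine ⟨fun p hp => ?_, hσs⟩
    rcases hp.eq_or_lt with hp | hp
    · rwa [hp, pos_val_self] at hσN
    · rw [hσ p hp, hval p hp]
  · rintro ⟨hσ, hσs⟩
    exact ⟨⟨fun p hp => (hσ p (by lia)).trans (hval p hp), hσs⟩, hσ _ (pos_val hN).ge⟩

theorem lettersPart_union (Z Z' : Finset (Fin (n + 1))) :
    lettersPart n N g (Z ∪ Z') = lettersPart n N g Z ∪ lettersPart n N g Z' := by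
  simp only [lettersPart, mem_union, filter_or]

theorem disjoint_lettersPart {Z Z' : Finset (Fin (n + 1))} (h : Disjoint Z Z') :
    Disjoint (lettersPart n N g Z) (lettersPart n N g Z') :=
  disjoint_filter.2 fun _ _ => fun hZ => disjoint_left.1 h hZ

theorem two_mul_card_lettersPart_of_forall {c : ℕ} (h2 : 2 ≤ N) (hN : N ≤ n)
    (hc : ∀ e, 2 * #(tailCoset n N e) = c) {Z : Finset (Fin (n + 1))}
    (hZ : Z ⊆ headLetters n N g) : 2 * #(lettersPart n N g Z) = #Z * c := by
  have hfiber : ∀ z ∈ Z, 2 * #{σ ∈ lettersPart n N g Z | σ (pos n N) = z} = c := by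
    intro z hz
    obtain ⟨e, he, rfl⟩ := exists_mem_tailCoset_apply_eq h2 hN (hZ hz)
    rw [← hc e, ← lettersPart_singleton hN he, lettersPart, filter_filter, lettersPart]
    simp only [mem_singleton]
    exact congrArg (2 * #·) (filter_congr fun σ _ => ⟨And.right, fun H => ⟨H ▸ hz, H⟩⟩)
  rw [card_eq_sum_card_fiberwise (f := fun σ => σ (pos n N)) (t := Z)
    (fun σ hσ => (mem_lettersPart.1 hσ).2), mul_sum, sum_congr rfl hfiber, sum_const, smul_eq_mul]

theorem two_mul_card_tailCoset (h2 : 2 ≤ N) (hN : N ≤ n + 1) (g : Perm (Fin (n + 1))) :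
    2 * #(tailCoset n N g) = N.factorial := by
  induction N, h2 using Nat.le_induction generalizing g with
  | base => simp [tailCoset_two]
  | succ N h2 ih =>
    rw [← lettersPart_headLetters (by lia),
      two_mul_card_lettersPart_of_forall h2 (by lia) (ih (by lia)) Subset.rfl,
      card_headLetters (by lia), Nat.factorial_succ]

theorem two_mul_card_lettersPart (h2 : 2 ≤ N) (hN : N ≤ n) {Z : Finset (Fin (n + 1))}
    (hZ : Z ⊆ headLetters n N g) :
    2 * #(lettersPart n N g Z) = #Z * N.factorial :=
  two_mul_card_lettersPart_of_forall h2 hN (two_mul_card_tailCoset h2 (by lia)) hZ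

end tailCoset

section RotTree

variable {n : ℕ}

section inductiveStep

variable {M : ℕ} {g h : Perm (Fin (n + 1))}

theorem lettersPart_insert_insert_erase {N : ℕ} {Y : Finset (Fin (n + 1))}
    (hh : h ∈ lettersPart n N g Y) {a b : Fin (n + 1)} (haY : a ∉ Y) (hbY : b ∉ Y) :
    (lettersPart n N g (insert a (insert b Y))).erase h =
      (lettersPart n N g Y).erase h ∪ lettersPart n N g {a} ∪ lettersPart n N g {b} := by
  have hz := (mem_lettersPart.1 hh).2
  have notMem {c : Fin (n + 1)} (hc : c ∉ Y) : h ∉ lettersPart n N g {c} := fun H =>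
    hc (mem_singleton.1 (mem_lettersPart.1 H).2 ▸ hz)
  rw [insert_eq, insert_eq, ← union_assoc, union_comm, lettersPart_union, lettersPart_union,
    ← union_assoc, erase_union_distrib, erase_union_distrib, erase_eq_of_notMem (notMem haY),
    erase_eq_of_notMem (notMem hbY)]

theorem isHypertree_lettersPart_insert_insert_erase (h2 : 2 ≤ M) (hM : M + 2 < n)
    (ih : ∀ g, IsHypertree (RotEdge n) ((tailCoset n (M + 2) g).erase g))
    {Y : Finset (Fin (n + 1))} (hh : h ∈ lettersPart n (M + 2) g Y)
    (hY : IsHypertree (RotEdge n) ((lettersPart n (M + 2) g Y).erase h)) {a b : Fin (n + 1)}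
    (ha : a ∈ headLetters n (M + 2) g) (hb : b ∈ headLetters n (M + 2) g) (hab : a ≠ b)
    (haY : a ∉ Y) (hbY : b ∉ Y) (hne : ¬ (h (pos n M) = a ∧ h (pos n (M + 1)) = b))
    (hne' : ¬ (h (pos n M) = b ∧ h (pos n (M + 1)) = a)) :
    IsHypertree (RotEdge n) ((lettersPart n (M + 2) g (insert a (insert b Y))).erase h) := by
  obtain ⟨hmem, hz⟩ := mem_lettersPart.1 hh
  have hzL := apply_pos_mem_headLetters hM.le hmem
  have haz : a ≠ h (pos n (M + 2)) := fun e => haY (e ▸ hz)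
  have hbz : b ≠ h (pos n (M + 2)) := fun e => hbY (e ▸ hz)
  obtain ⟨e, he, ea, eb, ez⟩ := exists_mem_tailCoset_apply_eq₃ h2 hM.le ha hb hzL hab haz hbz
  obtain ⟨f, hf, fb, fa, fz⟩ := exists_mem_tailCoset_apply_eq₃ h2 hM.le hb ha hzL hab.symm hbz haz
  have rot_mem {σ : Perm (Fin (n + 1))} (hσ : σ ∈ tailCoset n (M + 3) g) :
      σ * rot3 n M ∈ tailCoset n (M + 3) g := mul_rot3_mem_tailCoset hσ (by lia) (by lia)
  have fQ : (f * rot3 n M) (pos n (M + 2)) = b := (mul_rot3_apply_two f).trans fb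
  have fQQ : (f * rot3 n M * rot3 n M) (pos n (M + 2)) = a :=
    (mul_rot3_mul_rot3_apply_two hM.le f).trans fa
  have tree_erase {σ : Perm (Fin (n + 1))} (hσ : σ ∈ tailCoset n (M + 3) g) :
      IsHypertree (RotEdge n) ((lettersPart n (M + 2) g {σ (pos n (M + 2))}).erase σ) := by
    rw [lettersPart_singleton hM.le hσ]
    exact ih σ
  rw [lettersPart_insert_insert_erase hh haY hbY]
  refine hY.join_erase RotEdge.cyclic (e := e) (f := f) (a := e * rot3 n M)
    (b := e * rot3 n M * rot3 n M) (a' := f * rot3 n M * rot3 n M) (b' := f * rot3 n M)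
    (fQQ ▸ tree_erase (rot_mem (rot_mem hf))) (fQ ▸ tree_erase (rot_mem hf))
    (.mono_left (erase_subset _ _) (disjoint_lettersPart (disjoint_singleton_right.2 haY)))
    (.mono_left (erase_subset _ _) (disjoint_lettersPart (disjoint_singleton_right.2 hbY)))
    (disjoint_lettersPart (disjoint_singleton.2 hab))
    (mem_erase.2 ⟨fun E => hne (E ▸ ⟨ea, eb⟩), mem_lettersPart.2 ⟨he, ez ▸ hz⟩⟩)
    (mem_lettersPart.2 ⟨rot_mem he, mem_singleton.2 ((mul_rot3_apply_two e).trans ea)⟩) ?_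
    (mem_lettersPart.2 ⟨rot_mem (rot_mem he),
      mem_singleton.2 ((mul_rot3_mul_rot3_apply_two hM.le e).trans eb)⟩) ?_
    (rotEdge_mul_rot3 hM e)
    (mem_erase.2 ⟨fun E => hne' (E ▸ ⟨fb, fa⟩), mem_lettersPart.2 ⟨hf, fz ▸ hz⟩⟩)
    (mem_lettersPart.2 ⟨rot_mem (rot_mem hf), mem_singleton.2 fQQ⟩)
    (mem_lettersPart.2 ⟨rot_mem hf, mem_singleton.2 fQ⟩) (rotEdge_mul_rot3 hM f)
  · exact fun E => hbz (by
      rw [← eb, ← mul_rot3_apply_zero hM.le e, E, mul_rot3_mul_rot3_apply_zero hM.le, fz])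
  · exact fun E => haz (by
      rw [← fa, ← mul_rot3_apply_zero hM.le f, ← E, mul_rot3_mul_rot3_apply_zero hM.le, ez])

theorem isHypertree_lettersPart_union_erase (h2 : 2 ≤ M) (hM : M + 2 < n)
    (ih : ∀ g, IsHypertree (RotEdge n) ((tailCoset n (M + 2) g).erase g))
    {Y Z : Finset (Fin (n + 1))} (hh : h ∈ lettersPart n (M + 2) g Y)
    (hY : IsHypertree (RotEdge n) ((lettersPart n (M + 2) g Y).erase h))
    (hZ : Z ⊆ headLetters n (M + 2) g) (hYZ : Disjoint Y Z) (heven : Even #Z)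
    (hx : h (pos n M) ∉ Z) :
    IsHypertree (RotEdge n) ((lettersPart n (M + 2) g (Y ∪ Z)).erase h) := by
  obtain ⟨r, hr⟩ := heven
  induction r generalizing Y Z with
  | zero => rwa [card_eq_zero.1 hr, union_empty]
  | succ r ihr =>
    obtain ⟨Z', hZ', rest⟩ := exists_subset_card_eq (by lia : 2 ≤ #Z)
    obtain ⟨a, b, hab, rfl⟩ := card_eq_two.1 rest
    have ha : a ∈ Z := hZ' (by simp)
    have hb : b ∈ Z := hZ' (by simp)
    have hpair : IsHypertree (RotEdge n)
        ((lettersPart n (M + 2) g (insert a (insert b Y))).erase h) :=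
      isHypertree_lettersPart_insert_insert_erase h2 hM ih hh hY (hZ ha) (hZ hb) hab
        (disjoint_right.1 hYZ ha) (disjoint_right.1 hYZ hb) (fun e => hx (e.1 ▸ ha))
        (fun e => hx (e.1 ▸ hb))
    have hcard := card_sdiff_of_subset hZ'
    rw [rest, hr] at hcard
    have hunion : Y ∪ Z = insert a (insert b Y) ∪ (Z \ {a, b}) := by
      conv_lhs => rw [← union_sdiff_of_subset hZ']
      rw [← union_assoc, union_comm Y, insert_union, singleton_union]
    rw [hunion]
    refine ihr ?_ hpair (sdiff_subset.trans hZ) ?_ (fun H => hx (mem_sdiff.1 H).1) (by lia)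
    · exact mem_lettersPart.2 ⟨(mem_lettersPart.1 hh).1, by simp [(mem_lettersPart.1 hh).2]⟩
    · simp only [disjoint_insert_left, mem_sdiff, mem_insert, mem_singleton, true_or, or_true,
        not_true, and_false, not_false_iff, true_and]
      exact hYZ.mono_right sdiff_subset

theorem isHypertree_lettersPart_apply_erase (hM : M + 2 ≤ n)
    (ih : ∀ g, IsHypertree (RotEdge n) ((tailCoset n (M + 2) g).erase g))
    (hh : h ∈ tailCoset n (M + 3) g) :
    IsHypertree (RotEdge n) ((lettersPart n (M + 2) g {h (pos n (M + 2))}).erase h) := by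
  rw [lettersPart_singleton hM hh]
  exact ih h

theorem isHypertree_lettersPart_erase_of_apply_mem (h2 : 2 ≤ M) (hM : M + 2 < n)
    (ih : ∀ g, IsHypertree (RotEdge n) ((tailCoset n (M + 2) g).erase g))
    {Z : Finset (Fin (n + 1))} (hZ : Z ⊆ headLetters n (M + 2) g)
    (hh : h ∈ lettersPart n (M + 2) g Z) (hodd : Odd #Z) (h5 : 5 ≤ #Z)
    (hx : h (pos n M) ∈ Z) :
    IsHypertree (RotEdge n) ((lettersPart n (M + 2) g Z).erase h) := by
  obtain ⟨hmem, hz⟩ := mem_lettersPart.1 hh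
  set x := h (pos n M)
  set y := h (pos n (M + 1))
  set z := h (pos n (M + 2))
  have hxz : x ≠ z := apply_pos_ne h (by lia) (by lia) (by lia)
  have hh_start : h ∈ lettersPart n (M + 2) g {z} :=
    mem_lettersPart.2 ⟨hmem, mem_singleton_self z⟩
  -- The letter `x` must be joined first, and not together with `y`.
  obtain ⟨b, hb⟩ : (((Z.erase z).erase x).erase y).Nonempty := by
    have h₁ := card_erase_of_mem hz
    have h₂ := card_erase_of_mem (mem_erase.2 ⟨hxz, hx⟩)
    have h₃ := pred_card_le_card_erase (s := (Z.erase z).erase x) (a := y)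
    exact card_pos.1 (by lia)
  simp only [mem_erase] at hb
  obtain ⟨hby, hbx, hbz, hbZ⟩ := hb
  have hpair := isHypertree_lettersPart_insert_insert_erase h2 hM ih hh_start
    (isHypertree_lettersPart_apply_erase hM.le ih hmem) (hZ hx)
    (hZ hbZ) hbx.symm (by simpa using hxz) (by simpa using hbz) (fun e => hby e.2.symm)
    (fun e => hbx e.1.symm)
  have hsub : insert x (insert b {z}) ⊆ Z := by simp [insert_subset_iff, hx, hbZ, hz]
  have hcard : #(insert x (insert b {z})) = 3 :=
    card_eq_three.2 ⟨x, b, z, hbx.symm, hxz, hbz, rfl⟩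
  have hrest := isHypertree_lettersPart_union_erase h2 hM ih
    (mem_lettersPart.2 ⟨hmem, by simp [z]⟩) hpair (sdiff_subset.trans hZ)
    (disjoint_sdiff (s := insert x (insert b {z})) (t := Z)) (by
      rw [card_sdiff_of_subset hsub, hcard]
      exact hodd.tsub_odd (by decide)) (by simp [x])
  rwa [union_sdiff_of_subset hsub] at hrest

theorem isHypertree_lettersPart_erase (h2 : 2 ≤ M) (hM : M + 2 < n)
    (ih : ∀ g, IsHypertree (RotEdge n) ((tailCoset n (M + 2) g).erase g))
    {Z : Finset (Fin (n + 1))} (hZ : Z ⊆ headLetters n (M + 2) g)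
    (hh : h ∈ lettersPart n (M + 2) g Z) (hodd : Odd #Z) (h5 : 5 ≤ #Z) :
    IsHypertree (RotEdge n) ((lettersPart n (M + 2) g Z).erase h) := by
  by_cases hx : h (pos n M) ∈ Z
  · exact isHypertree_lettersPart_erase_of_apply_mem h2 hM ih hZ hh hodd h5 hx
  · obtain ⟨hmem, hz⟩ := mem_lettersPart.1 hh
    have heven : Even #(Z.erase (h (pos n (M + 2)))) :=
      card_erase_of_mem hz ▸ hodd.tsub_odd odd_one
    have hrest := isHypertree_lettersPart_union_erase h2 hM ih
      (mem_lettersPart.2 ⟨hmem, mem_singleton_self _⟩)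
      (isHypertree_lettersPart_apply_erase hM.le ih hmem)
      ((erase_subset _ Z).trans hZ) (by simp) heven (fun H => hx (mem_of_mem_erase H))
    rwa [← insert_eq, insert_erase hz] at hrest

end inductiveStep

end RotTree

section RotTree

variable {n : ℕ}

theorem tailCoset_three (hn : 2 ≤ n) (h : Perm (Fin (n + 1))) :
    tailCoset n 3 h = {h} ∪ {h * rot3 n 0} ∪ {h * rot3 n 0 * rot3 n 0} := by
  have memQ : h * rot3 n 0 ∈ tailCoset n 3 h :=
    mul_rot3_mem_tailCoset self_mem_tailCoset (by lia) (by lia)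
  have memQQ : h * rot3 n 0 * rot3 n 0 ∈ tailCoset n 3 h :=
    mul_rot3_mem_tailCoset memQ (by lia) (by lia)
  have hcard := two_mul_card_tailCoset (n := n) (N := 3) (by lia) (by lia) h
  rw [show Nat.factorial 3 = 2 * 3 from rfl] at hcard
  refine (eq_of_subset_of_card_le ?_ ?_).symm
  · simp only [union_subset_iff, singleton_subset_iff]
    exact ⟨⟨self_mem_tailCoset, memQ⟩, memQQ⟩
  · rw [Nat.eq_of_mul_eq_mul_left two_pos hcard, union_assoc]
    exact (card_eq_three.2 ⟨_, _, _, (mul_rot3_ne_self hn h).symm,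
      (mul_rot3_mul_rot3_ne_self hn h).symm, (mul_rot3_ne_self hn _).symm, rfl⟩).ge

theorem isHypertree_tailCoset_three (hn : 2 < n) (h : Perm (Fin (n + 1))) :
    IsHypertree (RotEdge n) (tailCoset n 3 h) := by
  rw [tailCoset_three hn.le]
  exact (isHypertree_singleton h).join RotEdge.cyclic (isHypertree_singleton _)
    (isHypertree_singleton _) (disjoint_singleton.2 (mul_rot3_ne_self hn.le h).symm)
    (disjoint_singleton.2 (mul_rot3_mul_rot3_ne_self hn.le h).symm)
    (disjoint_singleton.2 (mul_rot3_ne_self hn.le _).symm) (mem_singleton_self _)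
    (mem_singleton_self _) (mem_singleton_self _) (rotEdge_mul_rot3 hn h)

theorem headLetters_three (hn : 3 ≤ n) (g : Perm (Fin (n + 1))) :
    headLetters n 3 g = {g (pos n 0), g (pos n 1), g (pos n 2), g (pos n 3)} := by
  ext z
  obtain ⟨p, rfl⟩ := g.surjective z
  rw [mem_headLetters, perm_inv_apply_self]
  simp only [mem_insert, mem_singleton, g.injective.eq_iff, Fin.ext_iff, pos_val hn,
    pos_val (by lia : 0 ≤ n), pos_val (by lia : 1 ≤ n), pos_val (by lia : 2 ≤ n)]
  lia

theorem notMem_lettersPart_three (hn : 3 ≤ n) {g σ : Perm (Fin (n + 1))}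
    (hσ : σ (pos n 3) = g (pos n 3)) {i : ℕ} (hi : i < 3) :
    σ ∉ lettersPart n 3 g {g (pos n i)} := fun H =>
  apply_pos_ne g (by lia) hn hi.ne ((mem_singleton.1 (mem_lettersPart.1 H).2).symm.trans hσ)

theorem tailCoset_four_erase (hn : 3 ≤ n) (g : Perm (Fin (n + 1))) :
    (tailCoset n 4 g).erase g = {g * rot3 n 0} ∪ lettersPart n 3 g {g (pos n 2)} ∪
      lettersPart n 3 g {g (pos n 0)} ∪ lettersPart n 3 g {g (pos n 1)} ∪
      {g * rot3 n 0 * rot3 n 0} := by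
  have hhead : headLetters n 3 g =
      {g (pos n 3)} ∪ {g (pos n 2)} ∪ {g (pos n 0)} ∪ {g (pos n 1)} := by
    rw [headLetters_three hn]
    ext z
    simp only [mem_insert, mem_singleton, mem_union]
    tauto
  have hlast : lettersPart n 3 g {g (pos n 3)} =
      {g} ∪ {g * rot3 n 0} ∪ {g * rot3 n 0 * rot3 n 0} := by
    rw [lettersPart_singleton hn self_mem_tailCoset, tailCoset_three (by lia)]
  have notMem {i : ℕ} (hi : i < 3) := notMem_lettersPart_three hn (rfl : g (pos n 3) = _) hi
  rw [← lettersPart_headLetters hn, hhead, lettersPart_union, lettersPart_union,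
    lettersPart_union, hlast]
  simp only [erase_union_distrib, erase_eq_of_notMem (notMem _), Nat.lt_add_one, Nat.ofNat_pos,
    Nat.one_lt_ofNat, erase_singleton, empty_union]
  rw [erase_eq_of_notMem (by simpa using (mul_rot3_ne_self (by lia) g).symm),
    erase_eq_of_notMem (by simpa using (mul_rot3_mul_rot3_ne_self (by lia) g).symm)]
  ac_rfl

theorem disjoint_lettersPart_singleton {i j N : ℕ} (hi : i ≤ n) (hj : j ≤ n) (hij : i ≠ j)
    {g : Perm (Fin (n + 1))} (σ : Perm (Fin (n + 1))) :
    Disjoint (lettersPart n N g {σ (pos n i)}) (lettersPart n N g {σ (pos n j)}) :=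
  disjoint_lettersPart (disjoint_singleton.2 (apply_pos_ne σ hi hj hij))

theorem isHypertree_lettersPart_three_singleton (hn : 3 ≤ n) {g σ : Perm (Fin (n + 1))}
    {z : Fin (n + 1)} (hσ : σ ∈ lettersPart n 3 g {z}) :
    IsHypertree (RotEdge n) (lettersPart n 3 g {z}) := by
  obtain ⟨σ_mem, hz⟩ := mem_lettersPart.1 hσ
  rw [← mem_singleton.1 hz, lettersPart_singleton hn σ_mem]
  exact isHypertree_tailCoset_three (by lia) σ

theorem mul_rot3_one_mem_lettersPart (hn : 3 ≤ n) {g σ : Perm (Fin (n + 1))}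
    (hσ : σ ∈ tailCoset n 4 g) : σ * rot3 n 1 ∈ lettersPart n 3 g {σ (pos n 1)} :=
  mem_lettersPart.2 ⟨mul_rot3_mem_tailCoset hσ (by lia) (by lia),
    mem_singleton.2 (mul_rot3_apply_two σ)⟩

theorem mul_rot3_one_mul_rot3_one_mem_lettersPart (hn : 3 ≤ n) {g σ : Perm (Fin (n + 1))}
    (hσ : σ ∈ tailCoset n 4 g) :
    σ * rot3 n 1 * rot3 n 1 ∈ lettersPart n 3 g {σ (pos n 2)} :=
  mem_lettersPart.2 ⟨mul_rot3_mem_tailCoset (mul_rot3_mem_tailCoset hσ (by lia) (by lia))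
    (by lia) (by lia), mem_singleton.2 (mul_rot3_mul_rot3_apply_two hn σ)⟩

theorem isHypertree_union_lettersPart_three (hn : 3 < n) {g s : Perm (Fin (n + 1))}
    (hs : s ∈ tailCoset n 4 g) :
    IsHypertree (RotEdge n) ({s} ∪ lettersPart n 3 g {s (pos n 1)} ∪
      lettersPart n 3 g {s (pos n 2)}) := by
  have sQ_mem := mul_rot3_one_mem_lettersPart hn.le hs
  have sQQ_mem := mul_rot3_one_mul_rot3_one_mem_lettersPart hn.le hs
  have notMem {i : ℕ} (hi : i < 3) : s ∉ lettersPart n 3 g {s (pos n i)} := fun H =>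
    apply_pos_ne s (by lia) hn.le hi.ne (mem_singleton.1 (mem_lettersPart.1 H).2).symm
  exact (isHypertree_singleton s).join RotEdge.cyclic
    (isHypertree_lettersPart_three_singleton hn.le sQ_mem)
    (isHypertree_lettersPart_three_singleton hn.le sQQ_mem)
    (disjoint_singleton_left.2 (notMem (by lia))) (disjoint_singleton_left.2 (notMem (by lia)))
    (disjoint_lettersPart_singleton (by lia) (by lia) (by lia) s) (mem_singleton_self _)
    sQ_mem sQQ_mem (rotEdge_mul_rot3 (by lia) s)

theorem isHypertree_tailCoset_four_erase (hn : 3 < n) (g : Perm (Fin (n + 1))) :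
    IsHypertree (RotEdge n) ((tailCoset n 4 g).erase g) := by
  set s := g * rot3 n 0
  set t := s * rot3 n 0
  have s_mem : s ∈ tailCoset n 4 g := mul_rot3_mem_tailCoset self_mem_tailCoset (by lia) (by lia)
  have t_mem : t ∈ tailCoset n 4 g := mul_rot3_mem_tailCoset s_mem (by lia) (by lia)
  have s₁ : s (pos n 1) = g (pos n 2) := mul_rot3_apply_one (by lia) g
  have s₂ : s (pos n 2) = g (pos n 0) := mul_rot3_apply_two g
  have s₃ : s (pos n 3) = g (pos n 3) :=
    mul_rot3_apply_of_ne (by lia) hn.le (by lia) (by lia) (by lia) g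
  have t₁ : t (pos n 1) = g (pos n 0) := (mul_rot3_apply_one (by lia) s).trans s₂
  have t₂ : t (pos n 2) = g (pos n 1) :=
    (mul_rot3_apply_two s).trans (mul_rot3_apply_zero (by lia) g)
  have t₃ : t (pos n 3) = g (pos n 3) :=
    (mul_rot3_apply_of_ne (by lia) hn.le (by lia) (by lia) (by lia) s).trans s₃
  have tQ_mem := t₁ ▸ mul_rot3_one_mem_lettersPart hn.le t_mem
  have tQQ_mem := t₂ ▸ mul_rot3_one_mul_rot3_one_mem_lettersPart hn.le t_mem
  have disj {i j : ℕ} (hi : i < 3) (hj : j < 3) (hij : i ≠ j) :=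
    disjoint_lettersPart_singleton (N := 3) (by lia : i ≤ n) (by lia : j ≤ n) hij (g := g) g
  have notMem := @notMem_lettersPart_three n hn.le g
  have joined := isHypertree_union_lettersPart_three hn s_mem
  rw [s₁, s₂] at joined
  rw [tailCoset_four_erase hn.le]
  refine joined.join RotEdge.cyclic (isHypertree_lettersPart_three_singleton hn.le tQQ_mem)
    (isHypertree_singleton t) ?_ ?_ (disjoint_singleton_right.2 (notMem t₃ (by lia)))
    (mem_union_right _ tQ_mem) tQQ_mem (mem_singleton_self _)
    (RotEdge.cyclic _ _ _ (rotEdge_mul_rot3 (by lia) t))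
  · simp only [disjoint_union_left, disjoint_singleton_left]
    exact ⟨⟨notMem s₃ (by lia), disj (by lia) (by lia) (by lia)⟩,
      disj (by lia) (by lia) (by lia)⟩
  · simp only [disjoint_singleton_right, mem_union, mem_singleton, not_or]
    exact ⟨⟨mul_rot3_ne_self (by lia) s, notMem t₃ (by lia)⟩, notMem t₃ (by lia)⟩

section induction

variable {M : ℕ}

theorem isHypertree_tailCoset_erase_of_even (h2 : 2 ≤ M) (hM : M + 2 < n) (heven : Even M)
    (ih : ∀ g, IsHypertree (RotEdge n) ((tailCoset n (M + 2) g).erase g))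
    (g : Perm (Fin (n + 1))) : IsHypertree (RotEdge n) ((tailCoset n (M + 3) g).erase g) := by
  have hcard : #(headLetters n (M + 2) g) = M + 3 := card_headLetters hM.le
  rw [← lettersPart_headLetters hM.le]
  refine isHypertree_lettersPart_erase h2 hM ih Subset.rfl ?_ ?_ (by lia)
  · rw [lettersPart_headLetters hM.le]
    exact self_mem_tailCoset
  · rw [hcard]
    exact heven.add_odd (by decide)

theorem isHypertree_lettersPart_erase_letter (h3 : 3 ≤ M) (hM : M + 2 < n) (hodd : Odd M)
    (ih : ∀ g, IsHypertree (RotEdge n) ((tailCoset n (M + 2) g).erase g))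
    {g h : Perm (Fin (n + 1))} {z : Fin (n + 1)} (hz : z ∈ headLetters n (M + 2) g)
    (hh : h ∈ lettersPart n (M + 2) g ((headLetters n (M + 2) g).erase z)) :
    IsHypertree (RotEdge n)
      ((lettersPart n (M + 2) g ((headLetters n (M + 2) g).erase z)).erase h) := by
  have hcard : #((headLetters n (M + 2) g).erase z) = M + 2 := by
    rw [card_erase_of_mem hz, card_headLetters hM.le, Nat.add_sub_cancel]
  exact isHypertree_lettersPart_erase (by lia) hM ih (erase_subset _ _) hh
    (by rw [hcard]; exact hodd.add_even even_two) (by lia)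

theorem tailCoset_succ_erase {N : ℕ} (hN : N ≤ n) {g h : Perm (Fin (n + 1))}
    (hh : h ∈ lettersPart n N g ((headLetters n N g).erase (g (pos n N)))) :
    (tailCoset n (N + 1) g).erase g =
      (lettersPart n N g ((headLetters n N g).erase (g (pos n N)))).erase h ∪
        (lettersPart n N g {g (pos n N)}).erase g ∪ {h} := by
  have hg : g ∉ lettersPart n N g ((headLetters n N g).erase (g (pos n N))) := fun H =>
    notMem_erase _ _ (mem_lettersPart.1 H).2
  have hmem : g (pos n N) ∈ headLetters n N g := apply_pos_mem_headLetters hN self_mem_tailCoset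
  rw [← lettersPart_headLetters hN, union_right_comm, union_comm _ {h}, ← insert_eq,
    insert_erase hh, ← erase_eq_of_notMem hg, ← erase_union_distrib, ← lettersPart_union,
    union_comm, ← insert_eq, insert_erase hmem]

theorem isHypertree_tailCoset_erase_of_odd (h3 : 3 ≤ M) (hM : M + 2 < n) (hodd : Odd M)
    (ih : ∀ g, IsHypertree (RotEdge n) ((tailCoset n (M + 2) g).erase g))
    (g : Perm (Fin (n + 1))) : IsHypertree (RotEdge n) ((tailCoset n (M + 3) g).erase g) := by
  set z := g (pos n (M + 2))
  have z_mem : z ∈ headLetters n (M + 2) g := apply_pos_mem_headLetters hM.le self_mem_tailCoset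
  set Z := (headLetters n (M + 2) g).erase z with hZ
  set u := g * rot3 n 0
  set h := u * rot3 n M with hh
  have u_mem : u ∈ tailCoset n (M + 2) g :=
    mul_rot3_mem_tailCoset self_mem_tailCoset (by lia) (by lia)
  have rot_mem {σ : Perm (Fin (n + 1))} (hσ : σ ∈ tailCoset n (M + 3) g) :
      σ * rot3 n M ∈ tailCoset n (M + 3) g := mul_rot3_mem_tailCoset hσ (by lia) (by lia)
  have part_z : lettersPart n (M + 2) g {z} = tailCoset n (M + 2) g :=
    lettersPart_singleton hM.le self_mem_tailCoset
  have u_mem' : u ∈ lettersPart n (M + 2) g {z} := part_z ▸ u_mem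
  obtain ⟨u_mem₃, u_last⟩ := mem_lettersPart.1 u_mem'
  rw [mem_singleton] at u_last
  have mem_part {σ : Perm (Fin (n + 1))} (hσ : σ ∈ tailCoset n (M + 3) g)
      (hne : σ (pos n (M + 2)) ≠ z) : σ ∈ lettersPart n (M + 2) g Z :=
    mem_lettersPart.2 ⟨hσ, mem_erase.2 ⟨hne, apply_pos_mem_headLetters hM.le hσ⟩⟩
  have h_mem : h ∈ lettersPart n (M + 2) g Z := mem_part (rot_mem u_mem₃) (by
    rw [hh, mul_rot3_apply_two, ← u_last]
    exact apply_pos_ne u (by lia) hM.le (by lia))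
  have hQ_mem : h * rot3 n M ∈ lettersPart n (M + 2) g Z :=
    mem_part (rot_mem (rot_mem u_mem₃)) (by
      rw [hh, mul_rot3_mul_rot3_apply_two hM.le, ← u_last]
      exact apply_pos_ne u (by lia) hM.le (by lia))
  have disj : Disjoint (lettersPart n (M + 2) g Z) (lettersPart n (M + 2) g {z}) :=
    disjoint_lettersPart (by simp [hZ])
  rw [tailCoset_succ_erase hM.le h_mem]
  refine (isHypertree_lettersPart_erase_letter h3 hM hodd ih z_mem h_mem).join RotEdge.cyclic
    (part_z ▸ ih g) (isHypertree_singleton h)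
    (disj.mono (erase_subset _ _) (erase_subset _ _)) (by simp)
    (disjoint_singleton_right.2 fun H => disjoint_left.1 disj h_mem (mem_of_mem_erase H))
    (mem_erase.2 ⟨mul_rot3_ne_self hM.le h, hQ_mem⟩)
    (mem_erase.2 ⟨mul_rot3_ne_self (by lia) g, u_mem'⟩) (mem_singleton_self h) ?_
  exact RotEdge.cyclic _ _ _ (RotEdge.cyclic _ _ _ (rotEdge_mul_rot3 hM u))

end induction

theorem isHypertree_tailCoset_erase {N : ℕ} (h4 : 4 ≤ N) (hN : N ≤ n) (g : Perm (Fin (n + 1))) :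
    IsHypertree (RotEdge n) ((tailCoset n N g).erase g) := by
  induction N, h4 using Nat.le_induction generalizing g with
  | base => exact isHypertree_tailCoset_four_erase hN g
  | succ N h4 ih =>
    obtain ⟨M, rfl⟩ := Nat.exists_eq_add_of_le' (by lia : 2 ≤ N)
    rcases M.even_or_odd with heven | hodd
    · exact isHypertree_tailCoset_erase_of_even (by lia) (by lia) heven (ih (by lia)) g
    · have h3 : 3 ≤ M := by
        obtain ⟨r, rfl⟩ := hodd
        lia
      exact isHypertree_tailCoset_erase_of_odd h3 (by lia) hodd (ih (by lia)) g

theorem isHypertree_erase_letter {M : ℕ} (h3 : 3 ≤ M) (hM : M + 2 < n) (hodd : Odd M)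
    {g h : Perm (Fin (n + 1))} {z : Fin (n + 1)} (hz : z ∈ headLetters n (M + 2) g)
    (hh : h ∈ lettersPart n (M + 2) g ((headLetters n (M + 2) g).erase z)) :
    IsHypertree (RotEdge n)
      ((lettersPart n (M + 2) g ((headLetters n (M + 2) g).erase z)).erase h) :=
  isHypertree_lettersPart_erase_letter h3 hM hodd
    (isHypertree_tailCoset_erase (by lia) (by lia)) hz hh

end RotTree

/-- The permutation of the positions by which a push-to-the-top transition on the index `j` acts on
the right. -/
def top (n j : ℕ) : Perm (Fin (n + 1)) := (Fin.cycleIcc 0 (pos n j))⁻¹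

/-- The cyclic shift of the first `n` entries. -/
def shift (n : ℕ) : Perm (Fin (n + 1)) := top n (n - 1)

section shift

variable {n j : ℕ}

theorem top_val (hj : j ≤ n) (p : Fin (n + 1)) :
    (top n j p).val = if p.val = 0 then j else if p.val ≤ j then p.val - 1 else p.val := by
  have htop : top n j = pushToIndex 0 (pos n j) 1 := by rw [pushToIndex, one_mul]; rfl
  rw [htop]
  split_ifs with h₀ h₁
  · rw [show p = 0 from Fin.ext h₀, pushToIndex_apply_target (Fin.zero_le _), Perm.one_apply,
      pos_val hj]
  · have hp : p = pos n (p.val - 1) + 1 := by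
      have hlt : pos n (p.val - 1) < Fin.last n := by
        rw [Fin.lt_def, pos_val (by lia), Fin.val_last]
        lia
      apply Fin.ext
      rw [Fin.val_add_one_of_lt hlt, pos_val (by lia)]
      lia
    conv_lhs => rw [hp]
    rw [pushToIndex_apply_between (Fin.zero_le _) (by rw [Fin.lt_def, pos_val, pos_val] <;> lia),
      Perm.one_apply, pos_val (by lia)]
  · rw [pushToIndex_apply_outside (Or.inr (by rw [Fin.lt_def, pos_val] <;> lia)), Perm.one_apply]

theorem sign_top (hj : j ≤ n) : Perm.sign (top n j) = (-1) ^ j := by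
  rw [top, Perm.sign_inv, Fin.sign_cycleIcc_of_le (Fin.zero_le _), pos_val hj]
  rfl

theorem shift_val (p : Fin (n + 1)) :
    (shift n p).val = if p.val = 0 then n - 1 else if p.val ≤ n - 1 then p.val - 1 else p.val :=
  top_val (by lia) p

theorem sign_shift (hn : Odd n) : Perm.sign (shift n) = 1 := by
  rw [shift, sign_top (by lia)]
  exact (hn.tsub_odd odd_one).neg_one_pow

theorem shift_pow_val (hn : 1 ≤ n) (p : Fin (n + 1)) (i : ℕ) (hi : i ≤ n) :
    ((shift n ^ i) p).val =
      if p.val = n then n else if i ≤ p.val then p.val - i else p.val + n - i := by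
  induction i with
  | zero =>
    rw [pow_zero, Perm.one_apply]
    split_ifs <;> lia
  | succ i ih =>
    rw [pow_succ', Perm.mul_apply, shift_val, ih (by lia)]
    have := p.isLt
    split_ifs <;> lia

theorem shift_pow_self (hn : 1 ≤ n) : shift n ^ n = 1 := by
  ext p
  rw [shift_pow_val hn p n le_rfl, Perm.one_apply]
  have := p.isLt
  split_ifs <;> lia

theorem shift_pow_mod (hn : 1 ≤ n) (i : ℕ) : shift n ^ (i % n) = shift n ^ i := by
  conv_rhs => rw [← Nat.div_add_mod i n, pow_add, pow_mul, shift_pow_self hn, one_pow, one_mul]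

theorem shift_pow_pos (hn : 1 ≤ n) (hj : j < n) {i : ℕ} (hi : i ≤ j) :
    (shift n ^ i) (pos n j) = pos n (j - i) := by
  apply Fin.ext
  rw [shift_pow_val hn _ _ (by lia), pos_val (by lia), pos_val (by lia)]
  split_ifs <;> lia

theorem shift_pow_pos_last (hn : 1 ≤ n) (i : ℕ) : (shift n ^ i) (pos n n) = pos n n := by
  apply Fin.ext
  rw [← shift_pow_mod hn, shift_pow_val hn _ _ (Nat.mod_lt _ hn).le, pos_val le_rfl, if_pos rfl]

theorem shift_pow_eq_one (hj : j < n) {i : ℕ} (h : (shift n ^ i) (pos n j) = pos n j) :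
    shift n ^ i = 1 := by
  rw [← shift_pow_mod (by lia)] at h ⊢
  have hlt := Nat.mod_lt i (by lia : 0 < n)
  have hval := shift_pow_val (by lia) (pos n j) (i % n) hlt.le
  rw [h, pos_val (by lia)] at hval
  rw [show i % n = 0 by split_ifs at hval <;> lia, pow_zero]

theorem shift_pow_inj (hn : 1 ≤ n) {i j : ℕ} (hi : i < n) (hj : j < n)
    (h : shift n ^ i = shift n ^ j) : i = j := by
  have hval := shift_pow_val hn (pos n (n - 1)) i hi.le
  rw [h, shift_pow_val hn (pos n (n - 1)) j hj.le, pos_val (by lia)] at hval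
  split_ifs at hval <;> lia

theorem top_sub_three (hn : 3 ≤ n) : top n (n - 3) = rot3 n (n - 3) * shift n := by
  ext p
  rw [Perm.mul_apply, top_val (by lia), rot3_val (by lia), shift_val]
  have := p.isLt
  split_ifs <;> lia

theorem rot3_mul_shift (hj : j + 4 ≤ n) :
    rot3 n j * shift n = shift n * rot3 n (j + 1) := by
  ext p
  rw [Perm.mul_apply, Perm.mul_apply, shift_val, rot3_val (by lia), rot3_val (by lia), shift_val]
  have := p.isLt
  split_ifs <;> lia

theorem rot3_mul_shift_pow {c : ℕ} (h : j + c + 3 ≤ n) :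
    rot3 n j * shift n ^ c = shift n ^ c * rot3 n (j + c) := by
  induction c with
  | zero => simp
  | succ c ih =>
    rw [pow_succ, ← mul_assoc, ih (by lia), mul_assoc, rot3_mul_shift (by lia), mul_assoc,
      add_assoc]

theorem mul_shift_pow_mul_rot3 (hj : j + 3 ≤ n) (σ : Perm (Fin (n + 1))) :
    σ * shift n ^ (n - 3 - j) * rot3 n (n - 3) = σ * rot3 n j * shift n ^ (n - 3 - j) := by
  have h := rot3_mul_shift_pow (n := n) (j := j) (c := n - 3 - j) (by lia)
  rw [show j + (n - 3 - j) = n - 3 by lia] at h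
  rw [mul_assoc, ← h, mul_assoc]

end shift

section ringOf

variable {n : ℕ} {σ τ : Perm (Fin (n + 1))}

/-- The rings: the orbits of permutations under the cyclic shift of their first `n` entries. -/
abbrev ShiftRing (n : ℕ) : Type := Perm (Fin (n + 1)) ⧸ Subgroup.zpowers (shift n)

/-- The ring which contains a permutation. -/
def ringOf (σ : Perm (Fin (n + 1))) : ShiftRing n := σ

noncomputable instance : DecidableEq (ShiftRing n) := Classical.decEq _

theorem ringOf_eq_iff : ringOf σ = ringOf τ ↔ ∃ i : ℕ, σ * shift n ^ i = τ := by
  rw [ringOf, ringOf, QuotientGroup.eq, ← mem_powers_iff_mem_zpowers]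
  exact exists_congr fun i => eq_inv_mul_iff_mul_eq

theorem ringOf_mul_shift_pow (σ : Perm (Fin (n + 1))) (i : ℕ) :
    ringOf (σ * shift n ^ i) = ringOf σ :=
  (ringOf_eq_iff.2 ⟨i, rfl⟩).symm

theorem ringOf_mul_shift (σ : Perm (Fin (n + 1))) : ringOf (σ * shift n) = ringOf σ := by
  simpa only [pow_one] using ringOf_mul_shift_pow σ 1

theorem eq_of_ringOf_eq {j : ℕ} (hj : j < n) (hval : σ (pos n j) = τ (pos n j))
    (h : ringOf σ = ringOf τ) : σ = τ := by
  obtain ⟨i, rfl⟩ := ringOf_eq_iff.1 h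
  rw [shift_pow_eq_one hj (σ.injective hval).symm, mul_one]

/-- The hyperedges of rings which can be traversed together: the transition `top n (n - 3)` leads
from `u` to the ring of `uQ` and from there to the ring of `uQ²`, where `Q` is
`rot3 n (n - 3)`. -/
def RingEdge (n : ℕ) (A B C : ShiftRing n) : Prop :=
  ∃ u, A = ringOf u ∧ B = ringOf (u * rot3 n (n - 3)) ∧
    C = ringOf (u * rot3 n (n - 3) * rot3 n (n - 3))

theorem RotEdge.ringEdge {a b c : Perm (Fin (n + 1))} (h : RotEdge n a b c) :
    RingEdge n (ringOf a) (ringOf b) (ringOf c) := by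
  obtain ⟨j, hj, rfl, rfl⟩ := h
  refine ⟨a * shift n ^ (n - 3 - j), (ringOf_mul_shift_pow _ _).symm, ?_, ?_⟩
  · rw [mul_shift_pow_mul_rot3 (by lia), ringOf_mul_shift_pow]
  · rw [mul_shift_pow_mul_rot3 (by lia), mul_shift_pow_mul_rot3 (by lia), ringOf_mul_shift_pow]

/-- The permutations in the ring of `v`, in cyclic order and ending with `v`. -/
def ringList (n : ℕ) (v : Perm (Fin (n + 1))) : List (Perm (Fin (n + 1))) :=
  (List.range n).map fun i => v * shift n ^ (i + 1)

theorem mem_ringList (hn : 1 ≤ n) : σ ∈ ringList n τ ↔ ringOf σ = ringOf τ := by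
  rw [eq_comm, ringOf_eq_iff]
  simp only [ringList, List.mem_map, List.mem_range]
  constructor
  · rintro ⟨i, -, rfl⟩
    exact ⟨i + 1, rfl⟩
  · rintro ⟨i, rfl⟩
    refine ⟨(i + n - 1) % n, Nat.mod_lt _ hn, ?_⟩
    rw [← shift_pow_mod hn (_ + 1), ← shift_pow_mod hn i, Nat.mod_add_mod,
      show i + n - 1 + 1 = i + n by lia, Nat.add_mod_right]

theorem length_ringList (v : Perm (Fin (n + 1))) : (ringList n v).length = n := by
  rw [ringList, List.length_map, List.length_range]

theorem nodup_ringList (hn : 1 ≤ n) (v : Perm (Fin (n + 1))) : (ringList n v).Nodup := by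
  refine List.nodup_range.map_on fun i hi j hj h => ?_
  rw [pow_succ, pow_succ, ← mul_assoc, ← mul_assoc] at h
  exact shift_pow_inj hn (List.mem_range.1 hi) (List.mem_range.1 hj)
    (mul_left_cancel (mul_right_cancel h))

theorem ringList_eq_cons (hn : 1 ≤ n) (v : Perm (Fin (n + 1))) :
    ∃ l, ringList n v = v * shift n :: l := by
  obtain ⟨m, rfl⟩ : ∃ m, n = m + 1 := ⟨n - 1, by lia⟩
  exact ⟨_, by rw [ringList, List.range_succ_eq_map, List.map_cons, zero_add, pow_one]⟩

theorem ringList_eq_append (hn : 1 ≤ n) (v : Perm (Fin (n + 1))) :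
    ∃ l, ringList n v = l ++ [v] := by
  obtain ⟨m, rfl⟩ : ∃ m, n = m + 1 := ⟨n - 1, by lia⟩
  refine ⟨(List.range m).map fun i => v * shift (m + 1) ^ (i + 1), ?_⟩
  rw [ringList, List.range_succ, List.map_append, List.map_singleton, shift_pow_self hn, mul_one]

end ringOf

section Follows

variable {α : Type*} {x y : α} {l m : List α}

/-- `x` is immediately followed by `y` in the list `l`. -/
def Follows (x y : α) (l : List α) : Prop := ∃ l₁ l₂, l = l₁ ++ x :: y :: l₂

theorem Follows.mem_left (h : Follows x y l) : x ∈ l := by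
  obtain ⟨l₁, l₂, rfl⟩ := h
  simp

theorem Follows.append_right (h : Follows x y l) (m : List α) : Follows x y (l ++ m) := by
  obtain ⟨l₁, l₂, rfl⟩ := h
  exact ⟨l₁, l₂ ++ m, by simp⟩

theorem Follows.append_left (h : Follows x y l) (m : List α) : Follows x y (m ++ l) := by
  obtain ⟨l₁, l₂, rfl⟩ := h
  exact ⟨m ++ l₁, l₂, by simp⟩

theorem Follows.append_append (h : Follows x y l) (m m' : List α) : Follows x y (m ++ (l ++ m')) :=
  (h.append_right m').append_left m

theorem Follows.of_append_of_ne {u : α} (h : Follows x y (l ++ u :: m)) (hx : x ≠ u) :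
    Follows x y (l ++ [u]) ∨ Follows x y m := by
  obtain ⟨p, q, h⟩ := h
  rw [List.append_cons] at h
  rcases List.append_eq_append_iff.1 h with ⟨c, rfl, hc⟩ | ⟨c, hp, hc⟩
  · exact Or.inr ⟨c, q, hc⟩
  · match c, hp, hc with
    | [], _, hc => exact Or.inr ⟨[], q, by simpa using hc.symm⟩
    | [z], hp, hc =>
      obtain ⟨rfl, -⟩ := List.cons.inj hc
      exact absurd (List.append_inj_right' hp rfl |> List.singleton_inj.1).symm hx
    | z :: w :: r, hp, hc =>
      simp only [List.cons_append, List.cons.injEq] at hc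
      obtain ⟨rfl, rfl, -⟩ := hc
      exact Or.inl ⟨p, r, hp⟩

theorem Follows.splice {u v : α} (h : Follows x y (l ++ u :: v :: m)) (hx : x ≠ u)
    (k : List α) : Follows x y (l ++ u :: (k ++ v :: m)) := by
  rw [List.append_cons]
  rcases h.of_append_of_ne hx with h | h
  · exact h.append_right _
  · exact (h.append_left k).append_left _

end Follows

/-- One permutation is obtained from another by a "push-to-the-top" transition. -/
def PushStep {n : ℕ} (σ τ : Perm (Fin (n + 1))) : Prop :=
  ∃ j : Fin (n + 1), 0 < j ∧ τ = pushToIndex 0 j σ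

/-- A list without repetitions from `x` to `y` whose steps are transitions. -/
structure IsPushPath {n : ℕ} (x y : Perm (Fin (n + 1))) (l : List (Perm (Fin (n + 1)))) :
    Prop where
  chain : l.IsChain PushStep
  nodup : l.Nodup
  head : l.head? = some x
  last : l.getLast? = some y

section IsPushPath

variable {n : ℕ} {x y : Perm (Fin (n + 1))} {l : List (Perm (Fin (n + 1)))}

theorem pushStep_mul_top {j : ℕ} (h0 : 0 < j) (hj : j ≤ n) (σ : Perm (Fin (n + 1))) :
    PushStep σ (σ * top n j) :=
  ⟨pos n j, by rw [Fin.lt_def, pos_val hj]; exact h0, rfl⟩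

theorem isPushPath_singleton (x : Perm (Fin (n + 1))) : IsPushPath x x [x] :=
  ⟨List.isChain_singleton x, List.nodup_singleton x, rfl, rfl⟩

theorem IsPushPath.append {x' y' : Perm (Fin (n + 1))} {l' : List (Perm (Fin (n + 1)))}
    (h : IsPushPath x y l) (h' : IsPushPath x' y' l') (hs : PushStep y x')
    (hd : List.Disjoint l l') : IsPushPath x y' (l ++ l') where
  chain := by
    refine List.isChain_append.2 ⟨h.chain, h'.chain, fun a ha b hb => ?_⟩
    rw [h.last] at ha
    rw [h'.head] at hb
    obtain rfl := Option.some.inj ha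
    obtain rfl := Option.some.inj hb
    exact hs
  nodup := List.nodup_append'.2 ⟨h.nodup, h'.nodup, hd⟩
  head := by rw [List.head?_append, h.head]; rfl
  last := by rw [List.getLast?_append, h'.last]; rfl

theorem IsPushPath.of_append_cons_cons {u w : Perm (Fin (n + 1))}
    {l₁ l₂ : List (Perm (Fin (n + 1)))} (h : IsPushPath x y (l₁ ++ u :: w :: l₂)) :
    IsPushPath x u (l₁ ++ [u]) ∧ IsPushPath w y (w :: l₂) ∧
      List.Disjoint (l₁ ++ [u]) (w :: l₂) := by
  obtain ⟨hchain, hnodup, hhead, hlast⟩ := h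
  rw [List.isChain_append_cons_cons] at hchain
  rw [List.append_cons] at hnodup hhead hlast
  obtain ⟨hnodup₁, hnodup₂, hdisj⟩ := List.nodup_append'.1 hnodup
  refine ⟨⟨hchain.1, hnodup₁, ?_, by simp⟩, ⟨hchain.2.2, hnodup₂, rfl, ?_⟩, hdisj⟩
  · rwa [List.head?_append_of_ne_nil _ (by simp)] at hhead
  · rwa [List.getLast?_append_cons] at hlast

theorem IsPushPath.splice {a b u w : Perm (Fin (n + 1))} {l₁ l₂ m : List (Perm (Fin (n + 1)))}
    (h : IsPushPath x y (l₁ ++ u :: w :: l₂)) (hm : IsPushPath a b m) (hua : PushStep u a)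
    (hbw : PushStep b w) (hd : List.Disjoint (l₁ ++ u :: w :: l₂) m) :
    IsPushPath x y (l₁ ++ u :: (m ++ w :: l₂)) := by
  obtain ⟨hu, hw, huw⟩ := h.of_append_cons_cons
  rw [List.append_cons, List.disjoint_append_left] at hd
  rw [List.append_cons]
  exact hu.append (hm.append hw hbw hd.2.symm) hua (List.disjoint_append_right.2 ⟨hd.1, huw⟩)

theorem isPushPath_ringList (hn : 2 ≤ n) (v : Perm (Fin (n + 1))) :
    IsPushPath (v * shift n) v (ringList n v) where
  chain := by
    rw [List.isChain_iff_getElem]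
    intro i hi
    simp only [ringList, List.getElem_map, List.getElem_range]
    rw [pow_succ _ (i + 1), ← mul_assoc]
    exact pushStep_mul_top (by lia) (by lia) _
  nodup := nodup_ringList (by lia) v
  head := by obtain ⟨l, hl⟩ := ringList_eq_cons (by lia) v; rw [hl]; rfl
  last := by obtain ⟨l, hl⟩ := ringList_eq_append (by lia) v; rw [hl]; simp

theorem follows_ringList (hn : 1 ≤ n) {v σ : Perm (Fin (n + 1))} (h : ringOf σ = ringOf v)
    (hne : σ ≠ v) : Follows σ (σ * shift n) (ringList n v) := by
  obtain ⟨i, rfl⟩ := ringOf_eq_iff.1 h.symm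
  have hlt := Nat.mod_lt i hn
  have hpos : i % n ≠ 0 := fun e => hne (by rw [← shift_pow_mod hn, e, pow_zero, mul_one])
  rw [← shift_pow_mod hn i]
  refine ⟨(ringList n v).take (i % n - 1), (ringList n v).drop (i % n + 1), ?_⟩
  have hdrop : (ringList n v).drop (i % n - 1) = v * shift n ^ (i % n) ::
      v * shift n ^ (i % n) * shift n :: (ringList n v).drop (i % n + 1) := by
    rw [List.drop_eq_getElem_cons (by rw [length_ringList]; lia),
      List.drop_eq_getElem_cons (by rw [length_ringList]; lia),
      show i % n - 1 + 1 + 1 = i % n + 1 by lia]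
    simp only [ringList, List.getElem_map, List.getElem_range]
    rw [show i % n - 1 + 1 = i % n by lia, pow_succ, mul_assoc]
  rw [← hdrop, List.take_append_drop]

end IsPushPath

section IsRingExtension

variable {n : ℕ} {x y u : Perm (Fin (n + 1))} {l₀ l : List (Perm (Fin (n + 1)))}
  {R : Finset (ShiftRing n)}

/-- The path `l` from `x` to `y` is obtained from `l₀` by inserting the rings in `R`, in such a way
that an edge of these rings has only been broken at a `σ` for which `σ * rot3 n (n - 3)` is
visited. -/
structure IsRingExtension (x y : Perm (Fin (n + 1))) (l₀ : List (Perm (Fin (n + 1))))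
    (R : Finset (ShiftRing n)) (l : List (Perm (Fin (n + 1)))) : Prop where
  isPushPath : IsPushPath x y l
  length : l.length = l₀.length + n * #R
  mem : ∀ σ, σ ∈ l ↔ σ ∈ l₀ ∨ ringOf σ ∈ R
  follows : ∀ σ, ringOf σ ∈ R → σ * rot3 n (n - 3) ∉ l → Follows σ (σ * shift n) l

theorem IsPushPath.isRingExtension (h : IsPushPath x y l) : IsRingExtension x y l ∅ l where
  isPushPath := h
  length := by simp
  mem := by simp
  follows := by simp

theorem pushStep_mul_rot3_mul_shift (hn : 4 ≤ n) (σ : Perm (Fin (n + 1))) :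
    PushStep σ (σ * rot3 n (n - 3) * shift n) := by
  rw [mul_assoc, ← top_sub_three (by lia)]
  exact pushStep_mul_top (by lia) (by lia) σ

theorem isPushPath_ringList_append (hn : 4 ≤ n) {b c : Perm (Fin (n + 1))}
    (hbc : b * rot3 n (n - 3) = c) (hne : ringOf b ≠ ringOf c) :
    IsPushPath (b * shift n) c (ringList n b ++ ringList n c) := by
  refine (isPushPath_ringList (by lia) b).append (isPushPath_ringList (by lia) c)
    (hbc ▸ pushStep_mul_rot3_mul_shift hn b) fun σ h₁ h₂ => ?_
  exact hne (((mem_ringList (by lia)).1 h₁).symm.trans ((mem_ringList (by lia)).1 h₂))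

theorem IsRingExtension.exists_insert_insert (hn : 4 ≤ n) (h : IsRingExtension x y l₀ R l)
    (hu : Follows u (u * shift n) l) {b c : Perm (Fin (n + 1))} (hub : u * rot3 n (n - 3) = b)
    (hbc : b * rot3 n (n - 3) = c) (hb : ∀ σ ∈ l, ringOf σ ≠ ringOf b)
    (hc : ∀ σ ∈ l, ringOf σ ≠ ringOf c) (hne : ringOf b ≠ ringOf c) :
    ∃ l', IsRingExtension x y l₀ (insert (ringOf b) (insert (ringOf c) R)) l' := by
  have hcu : c * rot3 n (n - 3) = u := by
    rw [← hbc, ← hub, mul_assoc, mul_assoc, ← mul_assoc (rot3 n (n - 3)),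
      rot3_mul_rot3_mul_rot3 (by lia), mul_one]
  have hul := hu.mem_left
  obtain ⟨l₁, l₂, rfl⟩ := hu
  have hpath := h.isPushPath.splice (isPushPath_ringList_append hn hbc hne)
    (hub ▸ pushStep_mul_rot3_mul_shift hn u)
    (hcu ▸ pushStep_mul_rot3_mul_shift hn c) fun σ h₁ h₂ => by
      rw [List.mem_append, mem_ringList (by lia), mem_ringList (by lia)] at h₂
      exact h₂.elim (hb σ h₁) (hc σ h₁)
  have hmem : ∀ σ, σ ∈ l₁ ++ u :: (ringList n b ++ ringList n c ++ u * shift n :: l₂) ↔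
      σ ∈ l₁ ++ u :: u * shift n :: l₂ ∨ ringOf σ = ringOf b ∨ ringOf σ = ringOf c := fun σ => by
    rw [← mem_ringList (by lia), ← mem_ringList (by lia)]
    simp only [List.mem_append, List.mem_cons]
    tauto
  have hnotMem : ∀ v, (∀ σ ∈ l₁ ++ u :: u * shift n :: l₂, ringOf σ ≠ ringOf v) → ringOf v ∉ R :=
    fun v hv hvR => hv v ((h.mem v).2 (Or.inr hvR)) rfl
  refine ⟨_, hpath, ?_, fun σ => ?_, fun σ hσ hσQ => ?_⟩
  · have hlength := h.length
    rw [card_insert_of_notMem (by simp [hne, hnotMem b hb]), card_insert_of_notMem (hnotMem c hc)]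
    simp only [List.length_append, List.length_cons, length_ringList] at hlength ⊢
    linarith
  · rw [hmem, h.mem, mem_insert, mem_insert]
    tauto
  · rw [hmem] at hσQ
    push Not at hσQ
    rw [mem_insert, mem_insert] at hσ
    rcases hσ with hσ | hσ | hσ
    · have hf := follows_ringList (by lia) hσ fun e => hσQ.2.2 (by rw [e, hbc])
      rw [List.append_cons, List.append_assoc (ringList n b)]
      exact hf.append_append _ _
    · have hf := follows_ringList (by lia) hσ fun e => hσQ.1 (by rwa [e, hcu])
      rw [List.append_cons]
      exact (hf.append_left (ringList n b)).append_append _ _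
    · exact (h.follows σ hσ hσQ.1).splice (fun e => hσQ.2.1 (by rw [e, hub])) _

theorem IsPushPath.exists_isRingExtension_of_grows (hn : 4 ≤ n) (h : IsPushPath x y l₀)
    (hu : Follows u (u * shift n) l₀) {b c : Perm (Fin (n + 1))} (hub : u * rot3 n (n - 3) = b)
    (hbc : b * rot3 n (n - 3) = c) (hne : ringOf b ≠ ringOf c)
    (hR : Grows (RingEdge n) {ringOf b, ringOf c} R) (hl₀ : ∀ σ ∈ l₀, ringOf σ ∉ R) :
    ∃ l, IsRingExtension x y l₀ R l := by
  induction hR with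
  | refl =>
    refine h.isRingExtension.exists_insert_insert hn hu hub hbc ?_ ?_ hne
    all_goals exact fun σ hσ e => hl₀ σ hσ (by simp [e])
  | @tail R _ _ hstep ih =>
    obtain ⟨_, _, _, ⟨w, rfl, rfl, rfl⟩, hw, hwb, hwc, hwbc, rfl⟩ := hstep
    obtain ⟨l, hl⟩ := ih fun σ hσ hσR => hl₀ σ hσ (by simp [hσR])
    have hfresh : ∀ v, ringOf v ∉ R →
        ringOf v ∈ insert (ringOf (w * rot3 n (n - 3)))
          (insert (ringOf (w * rot3 n (n - 3) * rot3 n (n - 3))) R) →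
        ∀ σ ∈ l, ringOf σ ≠ ringOf v := by
      intro v hvR hv σ hσ e
      exact ((hl.mem σ).1 hσ).elim (fun hσ => hl₀ σ hσ (e ▸ hv)) (fun hσ => hvR (e ▸ hσ))
    have hwb' := hfresh _ hwb (by simp)
    exact hl.exists_insert_insert hn (hl.follows w hw fun hm => hwb' _ hm rfl) rfl rfl hwb'
      (hfresh _ hwc (by simp)) hwbc

end IsRingExtension

section SameClass

variable {n j : ℕ} {x σ τ ρ : Perm (Fin (n + 1))}

/-- The permutations are in the same class: they have the same last entry and the same sign. For
odd `n`, a path that leaves a class has to use the transition `top n n`. -/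
def SameClass (σ τ : Perm (Fin (n + 1))) : Prop :=
  σ (pos n n) = τ (pos n n) ∧ Perm.sign σ = Perm.sign τ

theorem SameClass.refl (σ : Perm (Fin (n + 1))) : SameClass σ σ := ⟨rfl, rfl⟩

theorem SameClass.trans (h : SameClass σ τ) (h' : SameClass τ ρ) : SameClass σ ρ :=
  ⟨h.1.trans h'.1, h.2.trans h'.2⟩

theorem SameClass.symm (h : SameClass σ τ) : SameClass τ σ := ⟨h.1.symm, h.2.symm⟩

theorem sameClass_mul_rot3 (hj : j + 2 < n) (σ : Perm (Fin (n + 1))) :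
    SameClass (σ * rot3 n j) σ :=
  ⟨mul_rot3_apply_of_ne hj.le le_rfl (by lia) (by lia) (by lia) σ,
    by rw [Perm.sign_mul, sign_rot3 hj.le, mul_one]⟩

theorem sameClass_mul_top (hj : j < n) (heven : Even j) (σ : Perm (Fin (n + 1))) :
    SameClass (σ * top n j) σ := by
  refine ⟨?_, by rw [Perm.sign_mul, sign_top hj.le, heven.neg_one_pow, mul_one]⟩
  rw [Perm.mul_apply]
  congr 1
  apply Fin.ext
  rw [top_val hj.le, pos_val le_rfl]
  split_ifs <;> lia

theorem sameClass_mul_shift (hn : Odd n) (σ : Perm (Fin (n + 1))) :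
    SameClass (σ * shift n) σ :=
  sameClass_mul_top (by have := hn.pos; lia) (hn.tsub_odd odd_one) σ

theorem sameClass_mul_shift_pow (hn : Odd n) (σ : Perm (Fin (n + 1))) (i : ℕ) :
    SameClass (σ * shift n ^ i) σ := by
  induction i with
  | zero => rw [pow_zero, mul_one]; exact .refl σ
  | succ i ih =>
    rw [pow_succ, ← mul_assoc]
    exact (sameClass_mul_shift hn _).trans ih

theorem SameClass.of_ringOf_eq (hn : Odd n) (h : ringOf σ = ringOf τ) : SameClass σ τ := by
  obtain ⟨i, rfl⟩ := ringOf_eq_iff.1 h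
  exact (sameClass_mul_shift_pow hn σ i).symm

end SameClass

section classReps

variable {n : ℕ} {x σ τ : Perm (Fin (n + 1))}

theorem mul_shift_apply {j : ℕ} (h0 : 0 < j) (hj : j < n) (σ : Perm (Fin (n + 1))) :
    (σ * shift n) (pos n j) = σ (pos n (j - 1)) := by
  rw [Perm.mul_apply, ← pow_one (shift n), shift_pow_pos (by lia) hj h0]

theorem mul_shift_ne_self (hn : 2 ≤ n) (σ : Perm (Fin (n + 1))) : σ * shift n ≠ σ := fun e =>
  apply_pos_ne σ (by lia) (by lia) (by lia : n - 1 - 1 ≠ n - 1)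
    (by rw [← mul_shift_apply (by lia) (by lia), e])

theorem mul_rot3_apply_sub_three (hn : 3 ≤ n) (σ : Perm (Fin (n + 1))) :
    (σ * rot3 n (n - 3)) (pos n (n - 3)) = σ (pos n (n - 2)) := by
  rw [mul_rot3_apply_zero (by lia), show n - 3 + 1 = n - 2 by lia]

theorem mul_rot3_apply_sub_two (hn : 3 ≤ n) (σ : Perm (Fin (n + 1))) :
    (σ * rot3 n (n - 3)) (pos n (n - 2)) = σ (pos n (n - 1)) := by
  rw [show n - 2 = n - 3 + 1 by lia, mul_rot3_apply_one (by lia), show n - 3 + 2 = n - 1 by lia]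

theorem mul_rot3_apply_sub_one (hn : 3 ≤ n) (σ : Perm (Fin (n + 1))) :
    (σ * rot3 n (n - 3)) (pos n (n - 1)) = σ (pos n (n - 3)) := by
  rw [show n - 1 = n - 3 + 2 by lia, mul_rot3_apply_two]

/-- Representatives of the rings which are used for the path through the class of `x`: the entry at
the index `n - 1` is the one of `x * shift n`, and the entry at the index `n - 2` is not. -/
def classReps (x : Perm (Fin (n + 1))) : Finset (Perm (Fin (n + 1))) :=
  lettersPart n (n - 2) (x * shift n)
    ((headLetters n (n - 2) (x * shift n)).erase ((x * shift n) (pos n (n - 2))))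

theorem mem_classReps (hn : 4 ≤ n) (hodd : Odd n) : σ ∈ classReps x ↔
    SameClass σ x ∧ σ (pos n (n - 1)) = x (pos n (n - 2)) ∧
      σ (pos n (n - 2)) ≠ x (pos n (n - 3)) := by
  have hshift := sameClass_mul_shift hodd x
  rw [classReps, mem_lettersPart, mem_erase, mul_shift_apply (by lia) (by lia),
    show n - 2 - 1 = n - 3 from rfl]
  constructor
  · rintro ⟨hσ, hne, -⟩
    obtain ⟨hval, hsign⟩ := mem_tailCoset.1 hσ
    refine ⟨⟨(hval _ (by rw [pos_val le_rfl]; lia)).trans hshift.1, hsign.trans hshift.2⟩, ?_, hne⟩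
    rw [hval _ (by rw [pos_val (by lia)]; lia), mul_shift_apply (by lia) (by lia)]
    rfl
  · rintro ⟨hclass, hσ, hne⟩
    have hmem : σ ∈ tailCoset n (n - 2 + 1) (x * shift n) := by
      refine mem_tailCoset.2 ⟨fun p hp => ?_, (hclass.trans hshift.symm).2⟩
      have hp : p.val = n - 1 ∨ p.val = n := by lia
      rcases hp with hp | hp <;> rw [← pos_val_self p, hp]
      · rw [hσ, mul_shift_apply (by lia) (by lia)]
        rfl
      · exact (hclass.trans hshift.symm).1
    exact ⟨hmem, hne, apply_pos_mem_headLetters (by lia) hmem⟩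

theorem mul_shift_apply_mem_headLetters (x : Perm (Fin (n + 1))) :
    (x * shift n) (pos n (n - 2)) ∈ headLetters n (n - 2) (x * shift n) :=
  apply_pos_mem_headLetters (by lia) self_mem_tailCoset

theorem two_mul_card_classReps (hn : 4 ≤ n) (x : Perm (Fin (n + 1))) :
    2 * #(classReps x) = (n - 2) * (n - 2).factorial := by
  rw [classReps, two_mul_card_lettersPart (by lia) (by lia) (erase_subset _ _),
    card_erase_of_mem (mul_shift_apply_mem_headLetters x), card_headLetters (by lia),
    Nat.add_sub_cancel]

theorem isHypertree_classReps_erase (hn : 7 ≤ n) (hodd : Odd n) (hσ : σ ∈ classReps x) :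
    IsHypertree (RotEdge n) ((classReps x).erase σ) := by
  have hz := mul_shift_apply_mem_headLetters x
  rw [classReps] at hσ ⊢
  obtain ⟨M, rfl⟩ := Nat.exists_eq_add_of_le' (by lia : 4 ≤ n)
  exact isHypertree_erase_letter (by lia) (by lia) ((Nat.odd_add.1 hodd).2 (by decide)) hz hσ

theorem injOn_ringOf_classReps (hn : 4 ≤ n) (hodd : Odd n) (x : Perm (Fin (n + 1))) :
    Set.InjOn ringOf (classReps x : Set (Perm (Fin (n + 1)))) := fun σ hσ τ hτ h =>
  eq_of_ringOf_eq (by lia) (((mem_classReps hn hodd).1 hσ).2.1.trans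
    ((mem_classReps hn hodd).1 hτ).2.1.symm) h

theorem ringOf_ne_of_mem_classReps (hn : 4 ≤ n) (hodd : Odd n) (hσ : σ ∈ classReps x)
    (h₁ : τ (pos n (n - 1)) = x (pos n (n - 2))) (h₂ : τ (pos n (n - 2)) = x (pos n (n - 3))) :
    ringOf σ ≠ ringOf τ := fun e => by
  obtain ⟨-, hσ₁, hσ₂⟩ := (mem_classReps hn hodd).1 hσ
  exact hσ₂ (by rw [eq_of_ringOf_eq (by lia) (hσ₁.trans h₁.symm) e, h₂])

theorem ringOf_ne_ringOf_of_mem_classReps (hn : 4 ≤ n) (hodd : Odd n) (hσ : σ ∈ classReps x) :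
    ringOf σ ≠ ringOf x := by
  rw [← ringOf_mul_shift x]
  exact ringOf_ne_of_mem_classReps hn hodd hσ (mul_shift_apply (by lia) (by lia) x)
    (mul_shift_apply (by lia) (by lia) x)

theorem ringOf_ne_ringOf_mul_rot3_mul_rot3_of_mem_classReps (hn : 4 ≤ n) (hodd : Odd n)
    (hσ : σ ∈ classReps x) : ringOf σ ≠ ringOf (x * rot3 n (n - 3) * rot3 n (n - 3)) := by
  refine ringOf_ne_of_mem_classReps hn hodd hσ ?_ ?_
  · rw [mul_rot3_apply_sub_one (by lia), mul_rot3_apply_sub_three (by lia)]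
  · rw [mul_rot3_apply_sub_two (by lia), mul_rot3_apply_sub_one (by lia)]

theorem ringOf_mul_rot3_ne (hn : 4 ≤ n) (x : Perm (Fin (n + 1))) :
    ringOf (x * rot3 n (n - 3)) ≠ ringOf x := fun e =>
  mul_rot3_ne_self (by lia) x <| eq_of_ringOf_eq (j := 0) (by lia)
    (mul_rot3_apply_of_ne (by lia) (by lia) (by lia) (by lia) (by lia) x) e

theorem ringOf_mul_rot3_mul_rot3_ne (hn : 4 ≤ n) (x : Perm (Fin (n + 1))) :
    ringOf (x * rot3 n (n - 3) * rot3 n (n - 3)) ≠ ringOf x := fun e => by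
  have hx : x * rot3 n (n - 3) * rot3 n (n - 3) = x := eq_of_ringOf_eq (j := 0) (by lia)
    (by simp only [mul_rot3_apply_of_ne (n := n) (j := n - 3) (i := 0) (by lia) (by lia) (by lia)
      (by lia) (by lia)]) e
  refine apply_pos_ne x (i := n - 1) (j := n - 3) (by lia) (by lia) (by lia) ?_
  rw [← mul_rot3_apply_sub_two (by lia), ← mul_rot3_apply_sub_three (by lia), hx]

theorem mul_rot3_mul_shift_sq_mem_classReps (hn : 4 ≤ n) (hodd : Odd n) (x : Perm (Fin (n + 1))) :
    x * rot3 n (n - 3) * shift n ^ 2 ∈ classReps x := by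
  refine (mem_classReps hn hodd).2 ⟨(sameClass_mul_shift_pow hodd _ 2).trans
    (sameClass_mul_rot3 (by lia) x), ?_, ?_⟩
  · rw [Perm.mul_apply, shift_pow_pos (by lia) (by lia) (by lia), show n - 1 - 2 = n - 3 from rfl,
      mul_rot3_apply_sub_three (by lia)]
  · rw [Perm.mul_apply, shift_pow_pos (by lia) (by lia) (by lia), show n - 2 - 2 = n - 4 from rfl,
      mul_rot3_apply_of_ne (by lia) (by lia) (by lia) (by lia) (by lia)]
    exact apply_pos_ne x (by lia) (by lia) (by lia)

theorem mul_rot3_zero_mem_classReps (hn : 5 ≤ n) (hσ : σ ∈ classReps x) :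
    σ * rot3 n 0 ∈ classReps x := by
  rw [classReps, mem_lettersPart] at hσ ⊢
  rw [mul_rot3_apply_of_ne (by lia) (by lia) (by lia) (by lia) (by lia)]
  exact ⟨mul_rot3_mem_tailCoset hσ.1 (by lia) (by lia), hσ.2⟩

theorem exists_mem_classReps_forall_eq (hn : 7 ≤ n) (hodd : Odd n)
    {f v : Perm (Fin (n + 1))} (hv : v ∈ classReps x) (hf : ringOf f ≠ ringOf v) :
    ∃ h ∈ classReps x, h ≠ v ∧ ∀ g ∈ classReps x, ringOf g = ringOf f → g = h := by
  by_cases hex : ∃ g ∈ classReps x, ringOf g = ringOf f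
  · obtain ⟨h, hh, hhf⟩ := hex
    exact ⟨h, hh, fun e => hf (by rw [← hhf, e]), fun g hg hgf =>
      injOn_ringOf_classReps (by lia) hodd x hg hh (hgf.trans hhf.symm)⟩
  · exact ⟨v * rot3 n 0, mul_rot3_zero_mem_classReps (by lia) hv, mul_rot3_ne_self (by lia) v,
      fun g hg hgf => absurd ⟨g, hg, hgf⟩ hex⟩

theorem exists_grows_rotEdge (hn : 7 ≤ n) (hodd : Odd n) {f v : Perm (Fin (n + 1))}
    (hv : v ∈ classReps x) (hf : ringOf f ≠ ringOf v) {ε : ℕ} (hε : ε ≤ 1) :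
    ∃ B ⊆ classReps x, Grows (RotEdge n) {v} B ∧
      2 * #B + 4 * ε + 2 = (n - 2) * (n - 2).factorial ∧ ∀ g ∈ B, ringOf g ≠ ringOf f := by
  obtain ⟨h, hh, hhv, hhf⟩ := exists_mem_classReps_forall_eq hn hodd hv hf
  have hgrows := isHypertree_classReps_erase hn hodd hh v (mem_erase.2 ⟨hhv.symm, hv⟩)
  have hcard := two_mul_card_classReps (by lia) x
  have hcard_erase := card_erase_add_one hh
  have herase : ∀ B ⊆ (classReps x).erase h, ∀ g ∈ B, ringOf g ≠ ringOf f := fun B hB g hg hgf =>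
    ne_of_mem_erase (hB hg) (hhf g (mem_of_mem_erase (hB hg)) hgf)
  rcases Nat.le_one_iff_eq_zero_or_eq_one.1 hε with rfl | rfl
  · exact ⟨_, erase_subset _ _, hgrows, by lia, herase _ Subset.rfl⟩
  · have hbig : 5 * 5 ≤ (n - 2) * (n - 2).factorial :=
      Nat.mul_le_mul (by lia) (le_trans (by lia) (Nat.self_le_factorial (n - 2)))
    obtain ⟨B, hvB, hB, hBcard⟩ := hgrows.exists_last (by lia)
    exact ⟨B, hB.trans (erase_subset _ _), hvB, by lia, herase B hB⟩

theorem exists_grows_ringEdge (hn : 7 ≤ n) (hodd : Odd n) {x f : Perm (Fin (n + 1))}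
    (hf₁ : ringOf f ≠ ringOf (x * rot3 n (n - 3)))
    (hf₂ : ringOf f ≠ ringOf (x * rot3 n (n - 3) * rot3 n (n - 3))) {ε : ℕ} (hε : ε ≤ 1) :
    ∃ R, Grows (RingEdge n) {ringOf (x * rot3 n (n - 3)),
        ringOf (x * rot3 n (n - 3) * rot3 n (n - 3))} R ∧
      2 * #R + 4 * ε = (n - 2) * (n - 2).factorial ∧ ringOf x ∉ R ∧ ringOf f ∉ R ∧
      ∀ σ, ringOf σ ∈ R → SameClass σ x := by
  have hv := mul_rot3_mul_shift_sq_mem_classReps (by lia) hodd x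
  have hvring := ringOf_mul_shift_pow (x * rot3 n (n - 3)) 2
  obtain ⟨B, hB, hvB, hcard, hBf⟩ := exists_grows_rotEdge hn hodd (f := f) hv (by rwa [hvring]) hε
  set c := x * rot3 n (n - 3) * rot3 n (n - 3)
  have hcB : Disjoint (B.image ringOf) {ringOf c} := by
    simp only [disjoint_singleton_right, mem_image, not_exists, not_and]
    exact fun g hg =>
      ringOf_ne_ringOf_mul_rot3_mul_rot3_of_mem_classReps (by lia) hodd (hB hg)
  have hinj : Set.InjOn ringOf (B : Set (Perm (Fin (n + 1)))) :=
    (injOn_ringOf_classReps (by lia) hodd x).mono hB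
  refine ⟨B.image ringOf ∪ {ringOf c}, ?_, ?_, ?_, ?_, fun σ hσ => ?_⟩
  · have hgrows := (hvB.image hinj fun _ _ _ => RotEdge.ringEdge).union_right hcB
    rwa [image_singleton, hvring] at hgrows
  · rw [card_union_of_disjoint hcB, card_image_of_injOn hinj, card_singleton, ← hcard]
    ring
  · rw [mem_union, mem_image, mem_singleton, not_or]
    exact ⟨fun ⟨g, hg, hgx⟩ => ringOf_ne_ringOf_of_mem_classReps (by lia) hodd (hB hg) hgx,
      (ringOf_mul_rot3_mul_rot3_ne (by lia) x).symm⟩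
  · rw [mem_union, mem_image, mem_singleton, not_or]
    exact ⟨fun ⟨g, hg, hgf⟩ => hBf g hg hgf, hf₂⟩
  · rw [mem_union, mem_image, mem_singleton] at hσ
    rcases hσ with ⟨g, hg, hgσ⟩ | hσ
    · exact (SameClass.of_ringOf_eq hodd hgσ.symm).trans
        ((mem_classReps (by lia) hodd).1 (hB hg)).1
    · exact (SameClass.of_ringOf_eq hodd hσ).trans
        ((sameClass_mul_rot3 (by lia) _).trans (sameClass_mul_rot3 (by lia) x))

theorem isPushPath_pair (hn : 2 ≤ n) (x : Perm (Fin (n + 1))) :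
    IsPushPath x (x * shift n) [x, x * shift n] where
  chain := List.isChain_pair.2 (pushStep_mul_top (by lia) (by lia) x)
  nodup := List.nodup_cons.2 ⟨by simpa using (mul_shift_ne_self hn x).symm, List.nodup_singleton _⟩
  head := rfl
  last := rfl

theorem exists_class_path (hn : 7 ≤ n) (hodd : Odd n) {x f : Perm (Fin (n + 1))}
    (hf₁ : ringOf f ≠ ringOf (x * rot3 n (n - 3)))
    (hf₂ : ringOf f ≠ ringOf (x * rot3 n (n - 3) * rot3 n (n - 3))) {ε : ℕ} (hε : ε ≤ 1) :
    ∃ l, IsPushPath x (x * shift n) l ∧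
      2 * l.length + 4 * n * ε = 4 + n * ((n - 2) * (n - 2).factorial) ∧
      ∀ σ ∈ l, SameClass σ x ∧ (ringOf σ = ringOf f → σ = x ∨ σ = x * shift n) := by
  obtain ⟨R, hgrows, hcard, hx, hf, hclass⟩ := exists_grows_ringEdge hn hodd hf₁ hf₂ hε
  have hne := (ringOf_mul_rot3_ne (by lia) (x * rot3 n (n - 3))).symm
  obtain ⟨l, hl⟩ := (isPushPath_pair (by lia) x).exists_isRingExtension_of_grows (by lia)
    ⟨[], [], rfl⟩ rfl rfl hne hgrows (by
      simpa only [List.mem_cons, List.not_mem_nil, or_false, forall_eq_or_imp, forall_eq,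
        ringOf_mul_shift, and_self] using hx)
  refine ⟨l, hl.isPushPath, ?_, fun σ hσ => ?_⟩
  · rw [hl.length, ← hcard, List.length_cons, List.length_singleton]
    ring
  · rcases (hl.mem σ).1 hσ with hσ | hσ
    · rw [List.mem_pair] at hσ
      refine ⟨?_, fun _ => hσ⟩
      rcases hσ with rfl | rfl
      exacts [.refl σ, sameClass_mul_shift hodd x]
    · exact ⟨hclass σ hσ, fun e => absurd (e ▸ hσ) hf⟩

end classReps

section ShortPath

variable {n j N : ℕ} {σ τ : Perm (Fin (n + 1))}

theorem mul_top_mem_tailCoset (hj : j < N) (hN : N ≤ n + 1) (heven : Even j)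
    (h : σ ∈ tailCoset n N τ) : σ * top n j ∈ tailCoset n N τ := by
  obtain ⟨hval, hsign⟩ := mem_tailCoset.1 h
  refine mem_tailCoset.2 ⟨fun p hp => ?_, ?_⟩
  · rw [Perm.mul_apply, ← hval p hp]
    congr 1
    apply Fin.ext
    rw [top_val (by lia)]
    split_ifs <;> lia
  · rw [Perm.sign_mul, sign_top (by lia), heven.neg_one_pow, mul_one, hsign]

theorem mul_top_pow_mem_tailCoset (hj : j < N) (hN : N ≤ n + 1) (heven : Even j)
    (h : σ ∈ tailCoset n N τ) (i : ℕ) : σ * top n j ^ i ∈ tailCoset n N τ := by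
  induction i with
  | zero => rwa [pow_zero, mul_one]
  | succ i ih =>
    rw [pow_succ, ← mul_assoc]
    exact mul_top_mem_tailCoset hj hN heven ih

theorem sameClass_of_mem_tailCoset (hN : N ≤ n) (h : σ ∈ tailCoset n N τ) : SameClass σ τ :=
  ⟨(mem_tailCoset.1 h).1 _ (by rwa [pos_val le_rfl]), (mem_tailCoset.1 h).2⟩

theorem forall_mem_scanl_top_mem_tailCoset (hN : N ≤ n + 1) {js : List ℕ}
    (hjs : ∀ j ∈ js, j < N ∧ Even j) (h : σ ∈ tailCoset n N τ) :
    ∀ ρ ∈ js.scanl (fun ρ j => ρ * top n j) σ, ρ ∈ tailCoset n N τ := by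
  induction js generalizing σ with
  | nil => simpa using h
  | cons j js ih =>
    rw [List.forall_mem_cons] at hjs
    rw [List.scanl_cons, List.forall_mem_cons]
    exact ⟨h, ih hjs.2 (mul_top_mem_tailCoset hjs.1.1 hN hjs.1.2 h)⟩

theorem isChain_scanl_top {js : List ℕ} (h : ∀ j ∈ js, 0 < j ∧ j ≤ n) (σ : Perm (Fin (n + 1))) :
    (js.scanl (fun σ j => σ * top n j) σ).IsChain PushStep := by
  rw [List.isChain_iff_getElem]
  intro i hi
  rw [List.length_scanl] at hi
  have hj := h _ (List.getElem_mem (by lia : i < js.length))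
  rw [List.getElem_succ_scanl]
  exact pushStep_mul_top hj.1 hj.2 _

theorem top_pow_val (hj : j ≤ n) (p : Fin (n + 1)) (i : ℕ) (hi : i ≤ j + 1) :
    ((top n j ^ i) p).val =
      if j < p.val then p.val else if i ≤ p.val then p.val - i else p.val + (j + 1) - i := by
  induction i with
  | zero => simp only [pow_zero, Perm.one_apply]; split_ifs <;> lia
  | succ i ih =>
    rw [pow_succ', Perm.mul_apply, top_val hj, ih (by lia)]
    split_ifs <;> lia

theorem top_pow_succ_self (hj : j ≤ n) : top n j ^ (j + 1) = 1 := by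
  ext p
  rw [top_pow_val hj _ _ le_rfl, Perm.one_apply]
  split_ifs <;> lia

theorem isPushPath_map_top_pow {m : ℕ} (h0 : 0 < j) (hj : j ≤ n) (hm : m ≤ j)
    (σ : Perm (Fin (n + 1))) :
    IsPushPath σ (σ * top n j ^ m) ((List.range (m + 1)).map fun i => σ * top n j ^ i) where
  chain := by
    rw [List.isChain_iff_getElem]
    intro i hi
    simp only [List.getElem_map, List.getElem_range]
    rw [pow_succ, ← mul_assoc]
    exact pushStep_mul_top h0 hj _
  nodup := by
    refine List.nodup_range.map_on fun a ha b hb h => ?_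
    have hval := congrArg (fun ρ : Perm (Fin (n + 1)) => (ρ (pos n j)).val) (mul_left_cancel h)
    rw [List.mem_range] at ha hb
    rw [top_pow_val hj _ _ (by lia), top_pow_val hj _ _ (by lia), pos_val hj] at hval
    split_ifs at hval <;> lia
  head := by rw [List.range_succ_eq_map, List.map_cons, pow_zero, mul_one]; rfl
  last := by rw [List.range_succ, List.map_append, List.map_singleton, List.getLast?_concat]

theorem top_two_pow_ne_top_zpow (hj : 3 ≤ j) (hjn : j ≤ n) {a : ℕ} (ha : a = 1 ∨ a = 2) (b : ℤ) :
    top n 2 ^ a ≠ top n j ^ b := fun h => by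
  have hcomm : Commute (top n 2 ^ a) (top n j) := by rw [h]; exact (Commute.refl _).zpow_left b
  have hval := congrArg (fun ρ : Perm (Fin (n + 1)) => (ρ (pos n 0)).val) hcomm.eq
  simp only [Perm.mul_apply] at hval
  rw [top_pow_val (by lia) _ _ (by lia), top_val hjn, top_val hjn,
    top_pow_val (by lia) _ _ (by lia), pos_val (by lia)] at hval
  rcases ha with rfl | rfl <;> split_ifs at hval <;> lia

theorem mul_top_zpow_ne (hj : 3 ≤ j) (hjn : j ≤ n) {a : ℕ} (ha : a = 1 ∨ a = 2)
    (σ : Perm (Fin (n + 1))) (b c : ℤ) :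
    σ * top n j ^ b ≠ σ * top n 2 ^ a * top n j ^ c := fun h => by
  rw [mul_assoc] at h
  refine top_two_pow_ne_top_zpow hj hjn ha (b - c) ?_
  rw [zpow_sub, mul_left_cancel h, mul_inv_cancel_right]

/-- The vertices of the path that applies `top n 2` to `σ`, and then `top n j` as often as is
possible without a repetition. -/
def hopList (n j : ℕ) (σ : Perm (Fin (n + 1))) : List (Perm (Fin (n + 1))) :=
  σ :: (List.range (j + 1)).map fun i => σ * top n 2 * top n j ^ i

theorem isPushPath_hopList (hj : 3 ≤ j) (hjn : j ≤ n) (σ : Perm (Fin (n + 1))) :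
    IsPushPath σ (σ * top n 2 * top n j ^ j) (hopList n j σ) := by
  refine (isPushPath_singleton σ).append (isPushPath_map_top_pow (by lia) hjn le_rfl (σ * top n 2))
    (pushStep_mul_top two_pos (by lia) σ) (List.singleton_disjoint.2 fun h => ?_)
  obtain ⟨i, -, h⟩ := List.mem_map.1 h
  refine mul_top_zpow_ne hj hjn (Or.inr rfl) (σ * top n 2) i 0 ?_
  rw [zpow_natCast, h, zpow_zero, mul_one, mul_assoc, ← pow_succ', top_pow_succ_self (by lia),
    mul_one]

theorem mem_tailCoset_of_mem_hopList (hj : 3 ≤ j) (hjN : j < N) (hN : N ≤ n + 1) (heven : Even j)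
    (hσ : σ ∈ hopList n j τ) : σ ∈ tailCoset n N τ := by
  rw [hopList, List.mem_cons, List.mem_map] at hσ
  rcases hσ with rfl | ⟨i, -, rfl⟩
  · exact self_mem_tailCoset
  · exact mul_top_pow_mem_tailCoset hjN hN heven
      (mul_top_mem_tailCoset (by lia) hN even_two self_mem_tailCoset) i

/-- The vertices of the path that applies `top n j` twice to `σ`, then `top n 2` twice, and then
`top n j` as often as is possible without a repetition. -/
def doubleHopList (n j : ℕ) (σ : Perm (Fin (n + 1))) : List (Perm (Fin (n + 1))) :=
  ((List.range 3).map fun i => σ * top n j ^ i) ++ hopList n j (σ * top n j ^ 2 * top n 2)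

theorem isPushPath_doubleHopList (hj : 3 ≤ j) (hjn : j ≤ n) (σ : Perm (Fin (n + 1))) :
    IsPushPath σ (σ * top n j ^ 2 * top n 2 ^ 2 * top n j ^ j) (doubleHopList n j σ) := by
  rw [pow_two (top n 2), ← mul_assoc]
  refine (isPushPath_map_top_pow (by lia) hjn (by lia) σ).append (isPushPath_hopList hj hjn _)
    (pushStep_mul_top two_pos (by lia) _) fun ρ hρ hρ' => ?_
  obtain ⟨i, -, rfl⟩ := List.mem_map.1 hρ
  have hi : σ * top n j ^ i = σ * top n j ^ 2 * top n j ^ ((i : ℤ) - 2) := by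
    rw [mul_assoc, ← zpow_natCast (top n j) i, ← zpow_ofNat (top n j) 2, ← zpow_add,
      add_sub_cancel]
  rw [hi, hopList, List.mem_cons, List.mem_map] at hρ'
  rcases hρ' with h | ⟨k, -, h⟩
  · exact mul_top_zpow_ne hj hjn (Or.inl rfl) _ (i - 2) 0 (by rw [h, pow_one, zpow_zero, mul_one])
  · exact mul_top_zpow_ne hj hjn (Or.inr rfl) _ (i - 2) k
      (by rw [← h, zpow_natCast, pow_two (top n 2), ← mul_assoc])

theorem mem_tailCoset_of_mem_doubleHopList (hj : 3 ≤ j) (hjN : j < N) (hN : N ≤ n + 1)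
    (heven : Even j) (hσ : σ ∈ doubleHopList n j τ) : σ ∈ tailCoset n N τ := by
  rw [doubleHopList, List.mem_append, List.mem_map] at hσ
  rcases hσ with ⟨i, -, rfl⟩ | hσ
  · exact mul_top_pow_mem_tailCoset hjN hN heven self_mem_tailCoset i
  · obtain ⟨hval, hsign⟩ := mem_tailCoset.1 (mem_tailCoset_of_mem_hopList hj hjN hN heven hσ)
    obtain ⟨hval', hsign'⟩ := mem_tailCoset.1 (mul_top_mem_tailCoset (by lia : 2 < N) hN even_two
      (mul_top_pow_mem_tailCoset hjN hN heven (self_mem_tailCoset (g := τ)) 2))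
    exact mem_tailCoset.2 ⟨fun p hp => (hval p hp).trans (hval' p hp), hsign.trans hsign'⟩

theorem top_mul_shift_mul_top_eq (hn : 9 ≤ n) :
    top n (n - 5) ^ 2 * top n 2 ^ 2 * top n (n - 5) ^ (n - 5) * shift n * top n 2 =
      shift n * top n (n - 5) := by
  ext p
  have h₁ := top_val (show 2 ≤ n by lia) p
  have h₂ := shift_val (top n 2 p)
  have h₃ := top_pow_val (show n - 5 ≤ n by lia) (shift n (top n 2 p)) (n - 5) (by lia)
  have h₄ := top_pow_val (show 2 ≤ n by lia) ((top n (n - 5) ^ (n - 5)) (shift n (top n 2 p))) 2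
    (by lia)
  have h₅ := top_pow_val (show n - 5 ≤ n by lia)
    ((top n 2 ^ 2) ((top n (n - 5) ^ (n - 5)) (shift n (top n 2 p)))) 2 (by lia)
  have h₆ := top_val (show n - 5 ≤ n by lia) p
  have h₇ := shift_val (top n (n - 5) p)
  simp only [Perm.mul_apply]
  generalize shift n (top n (n - 5) p) = q₇ at *
  generalize top n (n - 5) p = q₆ at *
  generalize (top n (n - 5) ^ 2) ((top n 2 ^ 2) _) = q₅ at *
  generalize (top n 2 ^ 2) _ = q₄ at *
  generalize (top n (n - 5) ^ (n - 5)) _ = q₃ at *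
  generalize shift n _ = q₂ at *
  generalize top n 2 p = q₁ at *
  have := p.isLt
  split_ifs at h₁ <;> split_ifs at h₂ <;> lia

theorem exists_short_class_path_of_nine_le (hn : 9 ≤ n) (hodd : Odd n) (x : Perm (Fin (n + 1))) :
    ∃ l, IsPushPath x (x * shift n) l ∧ l.length + 3 = 2 * n ∧ ∀ σ ∈ l, SameClass σ x := by
  have heven : Even (n - 5) := hodd.tsub_odd (by decide)
  set d := x * top n (n - 5) ^ 2 * top n 2 ^ 2 * top n (n - 5) ^ (n - 5) with hd
  have hend : d * shift n * top n 2 * top n (n - 5) ^ (n - 5) = x * shift n := by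
    have hid : d * shift n * top n 2 = x * shift n * top n (n - 5) := by
      rw [mul_assoc x, ← top_mul_shift_mul_top_eq hn, hd]
      simp only [mul_assoc]
    rw [hid, mul_assoc, ← pow_succ', top_pow_succ_self (by lia), mul_one]
  have hl := isPushPath_doubleHopList (by lia : 3 ≤ n - 5) (by lia) x
  have hl' := isPushPath_hopList (by lia : 3 ≤ n - 5) (by lia) (d * shift n)
  rw [hend] at hl'
  have hmem : ∀ σ ∈ doubleHopList n (n - 5) x, σ ∈ tailCoset n (n - 1) x := fun σ =>
    mem_tailCoset_of_mem_doubleHopList (by lia) (by lia) (by lia) heven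
  have hmem' : ∀ σ ∈ hopList n (n - 5) (d * shift n), σ ∈ tailCoset n (n - 1) (d * shift n) :=
    fun σ => mem_tailCoset_of_mem_hopList (by lia) (by lia) (by lia) heven
  have hdx := hmem d (List.mem_of_getLast? hl.last)
  have hne : (d * shift n) (pos n (n - 1)) ≠ d (pos n (n - 1)) := by
    rw [mul_shift_apply (by lia) (by lia)]
    exact apply_pos_ne d (by lia) (by lia) (by lia)
  refine ⟨_, hl.append hl' (pushStep_mul_top (by lia) (by lia) d) fun σ hσ hσ' => hne ?_, ?_,
    fun σ hσ => ?_⟩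
  · have hlast : n - 1 ≤ (pos n (n - 1)).val := (pos_val (by lia)).ge
    rw [← (mem_tailCoset.1 (hmem' σ hσ')).1 _ hlast, (mem_tailCoset.1 (hmem σ hσ)).1 _ hlast,
      (mem_tailCoset.1 hdx).1 _ hlast]
  · simp only [doubleHopList, hopList, List.length_append, List.length_map, List.length_range,
      List.length_cons]
    lia
  · rcases List.mem_append.1 hσ with hσ | hσ
    · exact sameClass_of_mem_tailCoset (by lia) (hmem σ hσ)
    · exact (sameClass_of_mem_tailCoset (by lia) (hmem' σ hσ)).trans
        ((sameClass_mul_shift hodd d).trans (sameClass_of_mem_tailCoset (by lia) hdx))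

theorem PushStep.mul_left (h : PushStep σ τ) (x : Perm (Fin (n + 1))) :
    PushStep (x * σ) (x * τ) := by
  obtain ⟨j, hj, rfl⟩ := h
  exact ⟨j, hj, (mul_assoc _ _ _).symm⟩

theorem IsPushPath.map_mul_left {l : List (Perm (Fin (n + 1)))} (h : IsPushPath σ τ l)
    (x : Perm (Fin (n + 1))) : IsPushPath (x * σ) (x * τ) (l.map (x * ·)) where
  chain := (List.isChain_map _).2 (h.chain.imp fun _ _ hs => hs.mul_left x)
  nodup := h.nodup.map (mul_right_injective x)
  head := by rw [List.head?_map, h.head]; rfl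
  last := by rw [List.getLast?_map, h.last]; rfl

/-- The indices of the transitions of a short path from `1` to `shift 7`. -/
def shortWord : List ℕ := [4, 6, 6, 2, 2, 6, 6, 6, 6, 4]

theorem isPushPath_scanl_shortWord :
    IsPushPath 1 (shift 7) (shortWord.scanl (fun σ j => σ * top 7 j) 1) where
  chain := isChain_scanl_top (by decide) 1
  nodup := by decide +kernel
  head := List.head?_scanl
  last := by rw [List.getLast?_scanl]; decide +kernel

theorem exists_short_class_path_seven (x : Perm (Fin (7 + 1))) :
    ∃ l, IsPushPath x (x * shift 7) l ∧ l.length + 3 = 2 * 7 ∧ ∀ σ ∈ l, SameClass σ x := by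
  refine ⟨_, mul_one x ▸ isPushPath_scanl_shortWord.map_mul_left x, ?_, fun σ hσ => ?_⟩
  · rw [List.length_map, List.length_scanl]
    rfl
  · obtain ⟨τ, hτ, rfl⟩ := List.mem_map.1 hσ
    obtain ⟨hval, hsign⟩ := sameClass_of_mem_tailCoset le_rfl
      (forall_mem_scanl_top_mem_tailCoset (by lia) (by decide) self_mem_tailCoset τ hτ)
    exact ⟨congrArg x hval, by rw [Perm.sign_mul, hsign, Perm.sign_one, mul_one]⟩

theorem exists_short_class_path (hn : 7 ≤ n) (hodd : Odd n) (x : Perm (Fin (n + 1))) :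
    ∃ l, IsPushPath x (x * shift n) l ∧ l.length + 3 = 2 * n ∧ ∀ σ ∈ l, SameClass σ x := by
  rcases (show n = 7 ∨ 9 ≤ n by obtain ⟨r, rfl⟩ := hodd; lia) with rfl | hn
  · exact exists_short_class_path_seven x
  · exact exists_short_class_path_of_nine_le hn hodd x

end ShortPath

section classStart

variable {n h i : ℕ}

theorem shift_mul_top_val (hn : 2 ≤ n) (p : Fin (n + 1)) :
    ((shift n * top n n) p).val =
      if p.val = 0 then n else if p.val = 1 then n - 1 else p.val - 2 := by
  rw [Perm.mul_apply, shift_val, top_val le_rfl]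
  have := p.isLt
  split_ifs <;> lia

/-- The first element of the `i`-th class of the code, counted from `0`. -/
def classStart (n i : ℕ) : Perm (Fin (n + 1)) := top n n * (shift n * top n n) ^ i

theorem classStart_zero : classStart n 0 = top n n := by rw [classStart, pow_zero, mul_one]

theorem classStart_succ (n i : ℕ) :
    classStart n (i + 1) = classStart n i * (shift n * top n n) := by
  rw [classStart, pow_succ, ← mul_assoc, classStart]

theorem sign_classStart (hodd : Odd n) (i : ℕ) : Perm.sign (classStart n i) = (-1) ^ (i + 1) := by
  rw [classStart, Perm.sign_mul, map_pow, Perm.sign_mul, sign_shift hodd, sign_top le_rfl, one_mul,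
    hodd.neg_one_pow, pow_succ']

theorem classStart_val (hn : n = 2 * h + 1) (hh : 1 ≤ h) (hi : i ≤ h) (p : Fin (n + 1)) :
    (classStart n i p).val =
      if p.val = 2 * i then n
      else if 2 * i ≤ p.val then p.val - 2 * i - 1
      else if p.val % 2 = 0 then p.val + n + 1 - 2 * i
      else p.val + n - 2 * i - 1 := by
  induction i generalizing p with
  | zero =>
    rw [classStart_zero, top_val le_rfl]
    have := p.isLt
    split_ifs <;> lia
  | succ i ih =>
    rw [classStart_succ, Perm.mul_apply, ih (by lia), shift_mul_top_val (by lia)]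
    have := p.isLt
    split_ifs <;> lia

theorem classStart_add_val (hn : n = 2 * h + 1) (hh : 1 ≤ h) {r : ℕ} (hr : r ≤ h)
    (p : Fin (n + 1)) :
    (classStart n (h + 1 + r) p).val =
      if p.val % 2 = 0 then if 2 * r ≤ p.val then p.val - 2 * r else p.val + n - 2 * r
      else if p.val = 2 * r + 1 then n
      else if 2 * r + 1 ≤ p.val then p.val - 2 - 2 * r
      else p.val + n - 2 * r := by
  induction r generalizing p with
  | zero =>
    rw [add_zero, classStart_succ, Perm.mul_apply, classStart_val hn hh le_rfl,
      shift_mul_top_val (by lia)]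
    have := p.isLt
    split_ifs <;> lia
  | succ r ih =>
    rw [← add_assoc, classStart_succ, Perm.mul_apply, ih (by lia), shift_mul_top_val (by lia)]
    have := p.isLt
    split_ifs <;> lia

theorem classStart_self_mul_shift (hn : 2 ≤ n) (hodd : Odd n) : classStart n n * shift n = 1 := by
  obtain ⟨h, hh⟩ := hodd
  have hstart := classStart_add_val hh (by lia) le_rfl
  rw [show h + 1 + h = n by lia] at hstart
  ext p
  rw [Perm.mul_apply, hstart, shift_val, Perm.one_apply]
  have := p.isLt
  split_ifs <;> lia

theorem classStart_last (hn : 2 ≤ n) (hodd : Odd n) (hi : i < n) :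
    (classStart n i (pos n n)).val = if 2 * i < n then n - 2 * i - 1 else 2 * n - 2 * i - 1 := by
  obtain ⟨h, hh⟩ := hodd
  rcases le_or_gt i h with hih | hih
  · rw [classStart_val hh (by lia) hih, pos_val le_rfl]
    split_ifs <;> lia
  · obtain ⟨r, rfl⟩ := Nat.exists_eq_add_of_le (Nat.succ_le_of_lt hih)
    rw [Nat.succ_eq_add_one, classStart_add_val hh (by lia) (by lia), pos_val le_rfl]
    split_ifs <;> lia

theorem classStart_last_ne (hn : 2 ≤ n) (hodd : Odd n) (hi : i < n) :
    classStart n i (pos n n) ≠ pos n n := fun e => by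
  have hval := classStart_last hn hodd hi
  rw [e, pos_val le_rfl] at hval
  split_ifs at hval <;> lia

theorem classStart_last_inj (hn : 2 ≤ n) (hodd : Odd n) {j : ℕ} (hi : i < n) (hj : j < n)
    (e : classStart n i (pos n n) = classStart n j (pos n n)) : i = j := by
  have hval := classStart_last hn hodd hi
  rw [e, classStart_last hn hodd hj] at hval
  obtain ⟨m, rfl⟩ := hodd
  split_ifs at hval <;> lia

end classStart

section lastSwap

variable {n : ℕ} {x σ τ : Perm (Fin (n + 1))}

/-- The transposition of the last letter of `σ` and the letter `n`. It is the only transposition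
`swap q n` for which `swap q n * σ` can have the last letter `n`. -/
def lastSwap (σ : Perm (Fin (n + 1))) : Perm (Fin (n + 1)) := swap (σ (pos n n)) (pos n n)

/-- Exchanging `n` with the last letter of `σ` leads neither to `1` nor to `(shift n)⁻¹`, which are
the first and the last element of the code. -/
def AvoidsEnds (σ : Perm (Fin (n + 1))) : Prop := σ ≠ lastSwap σ ∧ σ * shift n ≠ lastSwap σ

/-- The conditions on `x` under which a path from `x` to `x * shift n` through the class of `x` can
avoid the ends of the code: these are not reached in the pieces which every such path contains. -/
structure IsPathStart (x : Perm (Fin (n + 1))) : Prop where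
  ne_mul_shift_pow : ∀ k ≤ 2, lastSwap x ≠ x * shift n ^ k
  ringOf_ne_mul_rot3 : ringOf (lastSwap x) ≠ ringOf (x * rot3 n (n - 3))
  ringOf_ne_mul_rot3_mul_rot3 :
    ringOf (lastSwap x) ≠ ringOf (x * rot3 n (n - 3) * rot3 n (n - 3))

theorem SameClass.lastSwap_eq (h : SameClass σ τ) : lastSwap σ = lastSwap τ := by
  rw [lastSwap, h.1, lastSwap]

theorem sign_lastSwap (hσ : σ (pos n n) ≠ pos n n) : Perm.sign (lastSwap σ) = -1 :=
  Perm.sign_swap hσ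

theorem avoidsEnds_of_sign_eq_one (hodd : Odd n) (hσ : σ (pos n n) ≠ pos n n)
    (hsign : Perm.sign σ = 1) : AvoidsEnds σ := by
  have hne : ∀ τ, Perm.sign τ = 1 → τ ≠ lastSwap σ := fun τ hτ e =>
    absurd (hτ.symm.trans ((congrArg Perm.sign e).trans (sign_lastSwap hσ))) (by decide)
  exact ⟨hne σ hsign, hne _ (by rw [(sameClass_mul_shift hodd σ).2, hsign])⟩

theorem isPathStart_of_sign_eq_one (hn : 3 ≤ n) (hodd : Odd n) (hx : x (pos n n) ≠ pos n n)
    (hsign : Perm.sign x = 1) : IsPathStart x := by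
  have hring : ∀ τ, SameClass τ x → ringOf (lastSwap x) ≠ ringOf τ := fun τ hτ e => by
    have hswap := (SameClass.of_ringOf_eq hodd e).trans hτ
    exact absurd ((sign_lastSwap hx).symm.trans (hswap.2.trans hsign)) (by decide)
  refine ⟨fun k _ e => hring x (.refl x) ?_, hring _ (sameClass_mul_rot3 (by lia) x),
    hring _ ((sameClass_mul_rot3 (by lia) _).trans (sameClass_mul_rot3 (by lia) x))⟩
  rw [e, ringOf_mul_shift_pow]

theorem isPathStart_of_lastSwap_eq (hn : 4 ≤ n) {k : ℕ} (hk : 3 ≤ k) (hkn : k < n)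
    (h : lastSwap x = x * shift n ^ k) : IsPathStart x := by
  have hring : ringOf (lastSwap x) = ringOf x := by rw [h, ringOf_mul_shift_pow]
  refine ⟨fun l hl e => ?_, ?_, ?_⟩
  · have := shift_pow_inj (by lia) hkn (by lia) (mul_left_cancel (h.symm.trans e))
    lia
  · rw [hring]
    exact (ringOf_mul_rot3_ne hn x).symm
  · rw [hring]
    exact (ringOf_mul_rot3_mul_rot3_ne hn x).symm

-- In the ring of `swap b n` the first `n` entries are those of a rotation of `0, …, n - 1`, up to
-- the one letter `b`, so that `c + 1` cannot stand directly before `c`.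
theorem ringOf_swap_ne_of_descent (hn : 3 ≤ n) {p c : ℕ} {b : Fin (n + 1)} (hp : p + 1 < n)
    (hc : c + 1 < n) (h₁ : σ (pos n p) = pos n (c + 1))
    (h₀ : σ (pos n (p + 1)) = pos n c) (hb₁ : pos n (c + 1) ≠ b) (hb₀ : pos n c ≠ b) :
    ringOf (swap b (pos n n)) ≠ ringOf σ := fun e => by
  obtain ⟨i, rfl⟩ := ringOf_eq_iff.1 e
  have hlt := Nat.mod_lt i (by lia : 0 < n)
  have hswap {d : ℕ} (hd : d < n) (hdb : pos n d ≠ b) : swap b (pos n n) (pos n d) = pos n d :=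
    swap_apply_of_ne_of_ne hdb (pos_ne (by lia) le_rfl (by lia))
  rw [Perm.mul_apply, ← shift_pow_mod (by lia), ← eq_symm_apply, symm_swap, hswap hc hb₁] at h₁
  rw [Perm.mul_apply, ← shift_pow_mod (by lia), ← eq_symm_apply, symm_swap,
    hswap (by lia) hb₀] at h₀
  have hval₁ := congrArg Fin.val h₁
  have hval₀ := congrArg Fin.val h₀
  rw [shift_pow_val (by lia) _ _ hlt.le, pos_val (by lia), pos_val (by lia)] at hval₁ hval₀
  split_ifs at hval₁ hval₀ <;> lia

theorem isPathStart_of_descent {p c : ℕ} (hp : p + 4 < n) (hc : c + 1 < n)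
    (h₁ : x (pos n p) = pos n (c + 1)) (h₀ : x (pos n (p + 1)) = pos n c) : IsPathStart x := by
  have hb₁ : pos n (c + 1) ≠ x (pos n n) := by
    rw [← h₁]
    exact apply_pos_ne x (by lia) le_rfl (by lia)
  have hb₀ : pos n c ≠ x (pos n n) := by
    rw [← h₀]
    exact apply_pos_ne x (by lia) le_rfl (by lia)
  have hring {τ : Perm (Fin (n + 1))} (h₁ : τ (pos n p) = pos n (c + 1))
      (h₀ : τ (pos n (p + 1)) = pos n c) : ringOf (lastSwap x) ≠ ringOf τ :=
    ringOf_swap_ne_of_descent (by lia) (by lia) hc h₁ h₀ hb₁ hb₀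
  have hrot {i : ℕ} (hi : i + 3 < n) (τ : Perm (Fin (n + 1))) :
      (τ * rot3 n (n - 3)) (pos n i) = τ (pos n i) :=
    mul_rot3_apply_of_ne (by lia) (by lia) (by lia) (by lia) (by lia) τ
  refine ⟨fun k _ e => hring h₁ h₀ (by rw [e, ringOf_mul_shift_pow]), hring ?_ ?_, hring ?_ ?_⟩
  · rw [hrot (by lia), h₁]
  · rw [hrot (by lia), h₀]
  · rw [hrot (by lia), hrot (by lia), h₁]
  · rw [hrot (by lia), hrot (by lia), h₀]

theorem exists_path_avoidsEnds (hn : 7 ≤ n) (hodd : Odd n) (hx : IsPathStart x) {ε : ℕ}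
    (hε : ε ≤ 1) :
    ∃ l, IsPushPath x (x * shift n) l ∧
      2 * l.length + 4 * n * ε = 4 + n * ((n - 2) * (n - 2).factorial) ∧
      ∀ σ ∈ l, SameClass σ x ∧ AvoidsEnds σ := by
  obtain ⟨l, hl, hlen, hmem⟩ := exists_class_path hn hodd hx.ringOf_ne_mul_rot3
    hx.ringOf_ne_mul_rot3_mul_rot3 hε
  refine ⟨l, hl, hlen, fun σ hσ => ⟨(hmem σ hσ).1, fun e => ?_, fun e => ?_⟩⟩
  all_goals
    obtain ⟨hclass, hends⟩ := hmem σ hσ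
    rw [hclass.lastSwap_eq] at e
  · rcases hends (by rw [e]) with rfl | rfl
    · exact hx.ne_mul_shift_pow 0 (by lia) (by rw [pow_zero, mul_one, ← e])
    · exact hx.ne_mul_shift_pow 1 (by lia) (by rw [pow_one, ← e])
  · rcases hends (by rw [← e, ringOf_mul_shift]) with rfl | rfl
    · exact hx.ne_mul_shift_pow 1 (by lia) (by rw [pow_one, ← e])
    · exact hx.ne_mul_shift_pow 2 le_rfl (by rw [pow_two, ← mul_assoc, ← e])

end lastSwap

section classStart

variable {n i : ℕ}

theorem lastSwap_classStart_zero (hn : 2 ≤ n) :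
    lastSwap (classStart n 0) = classStart n 0 * shift n ^ (n - 1) := by
  refine mul_right_cancel (b := shift n) ?_
  rw [mul_assoc, ← pow_succ, Nat.sub_add_cancel (by lia), shift_pow_self (by lia), mul_one]
  have hlast : classStart n 0 (pos n n) = pos n (n - 1) := by
    apply Fin.ext
    rw [classStart_zero, top_val le_rfl, pos_val le_rfl, pos_val (by lia)]
    split_ifs <;> lia
  ext p
  have hp := p.isLt
  rw [Perm.mul_apply, lastSwap, hlast, classStart_zero, top_val le_rfl, swap_apply_def]
  split_ifs with h₁ h₂ <;>
    simp only [Fin.ext_iff, shift_val, pos_val le_rfl, pos_val (show n - 1 ≤ n by lia)] at * <;>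
    split_ifs at * <;> lia

theorem lastSwap_classStart_sub_one (hn : 4 ≤ n) (hodd : Odd n) :
    lastSwap (classStart n (n - 1)) = classStart n (n - 1) * shift n ^ 3 := by
  have hlast : classStart n (n - 1) (pos n n) = pos n 1 := by
    apply Fin.ext
    rw [classStart_last (by lia) hodd (by lia), pos_val (by lia)]
    split_ifs <;> lia
  obtain ⟨h, hh⟩ := hodd
  have hstart := classStart_add_val hh (r := h - 1) (by lia) (by lia)
  rw [show h + 1 + (h - 1) = n - 1 by lia] at hstart
  ext p
  have hp := p.isLt
  rw [lastSwap, hlast, Perm.mul_apply, hstart, shift_pow_val (by lia) _ _ (by lia), swap_apply_def]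
  split_ifs with h₁ h₂ <;>
    simp only [Fin.ext_iff, pos_val le_rfl, pos_val (show 1 ≤ n by lia)] at * <;> lia

theorem exists_descent_classStart (hn : 7 ≤ n) (hodd : Odd n) (heven : Even i) (h0 : 0 < i)
    (hi : i + 1 < n) :
    ∃ p c, p + 4 < n ∧ c + 1 < n ∧ classStart n i (pos n p) = pos n (c + 1) ∧
      classStart n i (pos n (p + 1)) = pos n c := by
  obtain ⟨h, hh⟩ := hodd
  obtain ⟨t, ht⟩ := heven
  rcases le_or_gt i h with hih | hih
  · refine ⟨0, n - 2 * i, by lia, by lia, Fin.ext ?_, Fin.ext ?_⟩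
    all_goals
      rw [classStart_val hh (by lia) hih, pos_val (by lia), pos_val (by lia)]
      split_ifs <;> lia
  · obtain ⟨r, rfl⟩ := Nat.exists_eq_add_of_le (Nat.succ_le_of_lt hih)
    rw [Nat.succ_eq_add_one] at *
    refine ⟨2 * r + 2, 1, by lia, by lia, Fin.ext ?_, Fin.ext ?_⟩
    all_goals
      rw [classStart_add_val hh (by lia) (by lia), pos_val (by lia), pos_val (by lia)]
      split_ifs <;> lia

theorem isPathStart_classStart (hn : 7 ≤ n) (hodd : Odd n) (hi : i < n) :
    IsPathStart (classStart n i) := by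
  rcases Nat.even_or_odd i with heven | hiodd
  · rcases (by lia : i = 0 ∨ i = n - 1 ∨ 0 < i ∧ i + 1 < n) with rfl | rfl | ⟨h0, hi'⟩
    · exact isPathStart_of_lastSwap_eq (by lia) (by lia) (by lia)
        (lastSwap_classStart_zero (by lia))
    · exact isPathStart_of_lastSwap_eq (by lia) le_rfl (by lia)
        (lastSwap_classStart_sub_one (by lia) hodd)
    · obtain ⟨p, c, hp, hc, h₁, h₀⟩ := exists_descent_classStart hn hodd heven h0 hi'
      exact isPathStart_of_descent hp hc h₁ h₀
  · exact isPathStart_of_sign_eq_one (by lia) hodd (classStart_last_ne (by lia) hodd hi)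
      (by rw [sign_classStart hodd, hiodd.add_one.neg_one_pow])

end classStart

section Assembly

variable {n m : ℕ} {q : Fin (n + 1)} {σ τ : Perm (Fin (n + 1))} {l l' : List (Perm (Fin (n + 1)))}

/-- `σ` lies in one of the first `m` classes of the code. -/
def InClasses (n m : ℕ) (σ : Perm (Fin (n + 1))) : Prop :=
  ∃ i < m, SameClass σ (classStart n i)

theorem InClasses.mono {m' : ℕ} (h : InClasses n m σ) (hm : m ≤ m') : InClasses n m' σ := by
  obtain ⟨i, hi, hσ⟩ := h
  exact ⟨i, hi.trans_le hm, hσ⟩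

theorem InClasses.last_ne (hn : 2 ≤ n) (hodd : Odd n) (h : InClasses n n σ) :
    σ (pos n n) ≠ pos n n := by
  obtain ⟨i, hi, hσ⟩ := h
  rw [hσ.1]
  exact classStart_last_ne hn hodd hi

theorem InClasses.not_sameClass (hn : 2 ≤ n) (hodd : Odd n) (hm : m < n) (h : InClasses n m σ) :
    ¬ SameClass σ (classStart n m) := fun hσ => by
  obtain ⟨i, hi, hσ'⟩ := h
  exact hi.ne (classStart_last_inj hn hodd (hi.trans hm) hm (hσ'.symm.trans hσ).1)

theorem IsPushPath.append_class (hn : 2 ≤ n) (hodd : Odd n) (hm : m + 1 < n)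
    (h : IsPushPath (classStart n 0) (classStart n m * shift n) l)
    (hl : ∀ σ ∈ l, InClasses n (m + 1) σ ∧ AvoidsEnds σ)
    (h' : IsPushPath (classStart n (m + 1)) (classStart n (m + 1) * shift n) l')
    (hl' : ∀ σ ∈ l', SameClass σ (classStart n (m + 1)) ∧ AvoidsEnds σ) :
    IsPushPath (classStart n 0) (classStart n (m + 1) * shift n) (l ++ l') ∧
      ∀ σ ∈ l ++ l', InClasses n (m + 2) σ ∧ AvoidsEnds σ := by
  refine ⟨h.append h' ?_ fun σ hσ hσ' => (hl σ hσ).1.not_sameClass hn hodd hm (hl' σ hσ').1,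
    List.forall_mem_append.2 ⟨fun σ hσ => ⟨(hl σ hσ).1.mono (by lia), (hl σ hσ).2⟩,
      fun σ hσ => ⟨⟨m + 1, by lia, (hl' σ hσ).1⟩, (hl' σ hσ).2⟩⟩⟩
  rw [classStart_succ n m, ← mul_assoc]
  exact pushStep_mul_top (by lia) le_rfl _

theorem exists_path_two_classes (hn : 7 ≤ n) (hodd : Odd n) :
    ∃ l, IsPushPath (classStart n 0) (classStart n 1 * shift n) l ∧
      2 * l.length + 6 = 4 + n * ((n - 2) * (n - 2).factorial) ∧
      ∀ σ ∈ l, InClasses n 2 σ ∧ AvoidsEnds σ := by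
  obtain ⟨l, hl, hlen, hmem⟩ :=
    exists_path_avoidsEnds hn hodd (isPathStart_classStart hn hodd (by lia : 0 < n)) le_rfl
  obtain ⟨l', hl', hlen', hmem'⟩ := exists_short_class_path hn hodd (classStart n 1)
  obtain ⟨happ, hmem_app⟩ := hl.append_class (by lia) hodd (by lia)
    (fun σ hσ => ⟨⟨0, one_pos, (hmem σ hσ).1⟩, (hmem σ hσ).2⟩) hl' fun σ hσ =>
      ⟨hmem' σ hσ, avoidsEnds_of_sign_eq_one hodd
        (InClasses.last_ne (by lia) hodd ⟨1, by lia, hmem' σ hσ⟩)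
        (by rw [(hmem' σ hσ).2, sign_classStart hodd]; rfl)⟩
  refine ⟨l ++ l', happ, ?_, hmem_app⟩
  rw [List.length_append]
  lia

theorem exists_path_classes (hn : 7 ≤ n) (hodd : Odd n) (hm : 1 ≤ m) (hmn : m < n) :
    ∃ l, IsPushPath (classStart n 0) (classStart n m * shift n) l ∧
      2 * l.length + 6 = m * (4 + n * ((n - 2) * (n - 2).factorial)) ∧
      ∀ σ ∈ l, InClasses n (m + 1) σ ∧ AvoidsEnds σ := by
  induction m, hm using Nat.le_induction with
  | base => simpa only [one_mul] using exists_path_two_classes hn hodd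
  | succ m _ ih =>
    obtain ⟨l, hl, hlen, hmem⟩ := ih (by lia)
    obtain ⟨l', hl', hlen', hmem'⟩ :=
      exists_path_avoidsEnds hn hodd (isPathStart_classStart hn hodd hmn) (Nat.zero_le 1)
    obtain ⟨happ, hmem_app⟩ := hl.append_class (by lia) hodd hmn hmem hl' hmem'
    refine ⟨l ++ l', happ, ?_, hmem_app⟩
    rw [List.length_append, add_one_mul, ← hlen, ← hlen']
    ring

theorem classStart_self (hn : 2 ≤ n) (hodd : Odd n) : classStart n n = (shift n)⁻¹ :=
  eq_inv_of_mul_eq_one_left (classStart_self_mul_shift hn hodd)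

theorem classStart_self_last (hn : 2 ≤ n) (hodd : Odd n) : classStart n n (pos n n) = pos n n := by
  rw [classStart_self hn hodd, Perm.inv_eq_iff_eq, ← pow_one (shift n), shift_pow_pos_last (by lia)]

theorem classStart_self_ne_one (hn : 2 ≤ n) (hodd : Odd n) : classStart n n ≠ 1 := fun e =>
  mul_shift_ne_self hn 1 (e ▸ classStart_self_mul_shift hn hodd)

theorem exists_code_path (hn : 7 ≤ n) (hodd : Odd n) :
    ∃ l, IsPushPath 1 (classStart n n) (1 :: (top n n :: l ++ [classStart n n])) ∧
      2 * l.length + 8 = (n - 1) * (4 + n * ((n - 2) * (n - 2).factorial)) ∧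
      ∀ σ ∈ top n n :: l, InClasses n n σ ∧ AvoidsEnds σ := by
  obtain ⟨l, hl, hlen, hmem⟩ := exists_path_classes hn hodd (m := n - 1) (by lia) (by lia)
  rw [Nat.sub_add_cancel (by lia)] at hmem
  obtain ⟨t, rfl⟩ : ∃ t, l = top n n :: t :=
    ⟨l.tail, (List.cons_head?_tail (classStart_zero (n := n) ▸ hl.head)).symm⟩
  have hfirst : PushStep 1 (classStart n 0) := by
    rw [classStart_zero, ← one_mul (top n n)]
    exact pushStep_mul_top (by lia) le_rfl 1
  have hlast : PushStep (classStart n (n - 1) * shift n) (classStart n n) := by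
    have hsucc := classStart_succ n (n - 1)
    rw [Nat.sub_add_cancel (by lia), ← mul_assoc] at hsucc
    rw [hsucc]
    exact pushStep_mul_top (by lia) le_rfl _
  have hne : ∀ σ ∈ top n n :: t, σ (pos n n) ≠ pos n n := fun σ hσ =>
    (hmem σ hσ).1.last_ne (by lia) hodd
  refine ⟨t, (isPushPath_singleton 1).append (hl.append (isPushPath_singleton _) hlast ?_) hfirst
    ?_, by rw [← hlen, List.length_cons]; ring, hmem⟩
  · exact List.disjoint_singleton.2 fun h => hne _ h (classStart_self_last (by lia) hodd)
  · refine List.singleton_disjoint.2 fun h => ?_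
    rcases (List.mem_append (s := top n n :: t)).1 h with h | h
    exacts [hne 1 h rfl, classStart_self_ne_one (by lia) hodd (List.mem_singleton.1 h).symm]

theorem eq_lastSwap_mul (hτ : τ (pos n n) = pos n n) (h : swap q (pos n n) * σ = τ) :
    σ = lastSwap σ * τ := by
  have hq : σ (pos n n) = q := by
    rw [← h, Perm.mul_apply, ← eq_symm_apply, symm_swap, swap_apply_right] at hτ
    exact hτ
  rw [lastSwap, hq, ← h, swap_mul_self_mul]

theorem AvoidsEnds.swap_mul_ne_one (h : AvoidsEnds σ) (q : Fin (n + 1)) :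
    swap q (pos n n) * σ ≠ 1 := fun e =>
  h.1 ((eq_lastSwap_mul rfl e).trans (mul_one _))

theorem AvoidsEnds.swap_mul_ne_classStart_self (hn : 2 ≤ n) (hodd : Odd n) (h : AvoidsEnds σ)
    (q : Fin (n + 1)) : swap q (pos n n) * σ ≠ classStart n n := fun e => by
  refine h.2 ?_
  conv_lhs => rw [eq_lastSwap_mul (classStart_self_last hn hodd) e, mul_assoc,
    classStart_self_mul_shift hn hodd, mul_one]

theorem InClasses.not_inClasses_swap_mul (hn : 2 ≤ n) (hodd : Odd n) (hq : q ≠ pos n n)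
    (hσ : InClasses n n σ) : ¬ InClasses n n (swap q (pos n n) * σ) := fun hτ => by
  have hne : σ (pos n n) ≠ q := fun e =>
    hτ.last_ne hn hodd (by rw [Perm.mul_apply, e, swap_apply_left])
  have hlast : (swap q (pos n n) * σ) (pos n n) = σ (pos n n) :=
    swap_apply_of_ne_of_ne hne (hσ.last_ne hn hodd)
  obtain ⟨i, hi, hσi⟩ := hσ
  obtain ⟨j, hj, hτj⟩ := hτ
  obtain rfl := classStart_last_inj hn hodd hi hj (hσi.1.symm.trans (hlast.symm.trans hτj.1))
  have hsign := (hτj.trans hσi.symm).2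
  rw [Perm.sign_mul, Perm.sign_swap hq, mul_eq_right] at hsign
  exact absurd hsign (by decide)

theorem swap_mul_notMem (hn : 2 ≤ n) (hodd : Odd n)
    (hl : ∀ σ ∈ l, InClasses n n σ ∧ AvoidsEnds σ) (hq : q ≠ pos n n)
    (hσ : σ ∈ 1 :: (l ++ [classStart n n])) :
    swap q (pos n n) * σ ∉ 1 :: (l ++ [classStart n n]) := fun hτ => by
  have hcases : ∀ ρ ∈ 1 :: (l ++ [classStart n n]),
      ρ ∈ l ∨ (ρ = 1 ∨ ρ = classStart n n) ∧ ρ (pos n n) = pos n n := fun ρ hρ => by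
    rw [List.mem_cons, List.mem_append, List.mem_singleton] at hρ
    rcases hρ with rfl | hρ | rfl
    exacts [.inr ⟨.inl rfl, rfl⟩, .inl hρ, .inr ⟨.inr rfl, classStart_self_last hn hodd⟩]
  have hends : ∀ ρ ∈ l, ¬ (swap q (pos n n) * ρ = 1 ∨ swap q (pos n n) * ρ = classStart n n) :=
    fun ρ hρ => not_or.2 ⟨(hl ρ hρ).2.swap_mul_ne_one q,
      (hl ρ hρ).2.swap_mul_ne_classStart_self hn hodd q⟩
  rcases hcases _ hσ with hσ | ⟨hσ, hlast⟩ <;> rcases hcases _ hτ with hτ | ⟨hτ, hlast'⟩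
  · exact (hl σ hσ).1.not_inClasses_swap_mul hn hodd hq (hl _ hτ).1
  · exact hends σ hσ hτ
  · exact hends _ hτ (by rwa [swap_mul_self_mul])
  · rw [Perm.mul_apply, hlast, swap_apply_right] at hlast'
    exact hq hlast'

end Assembly

section IsAuxCode

variable {n : ℕ} {x y : Perm (Fin (n + 1))} {l : List (Perm (Fin (n + 1)))}

theorem top_eq_pos_self : (⊤ : Fin (n + 1)) = pos n n := Fin.ext (pos_val le_rfl).symm

theorem IsPushPath.isPushToTopCode_get (h : IsPushPath x y l) (hyx : PushStep y x) :
    IsPushToTopCode l.get where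
  injective := List.nodup_iff_injective_get.1 h.nodup
  step r hr := by
    obtain ⟨j, hj, hstep⟩ := List.isChain_iff_getElem.1 h.chain r hr
    exact ⟨_, ⟨j, hj, rfl⟩, hstep⟩
  cyclic := by
    have hpos : 0 < l.length := List.length_pos_of_mem (List.mem_of_getLast? h.last)
    have hhead := h.head
    have hlast := h.last
    rw [List.head?_eq_getElem?, List.getElem?_eq_getElem hpos] at hhead
    rw [List.getLast?_eq_getElem?, List.getElem?_eq_getElem (by lia)] at hlast
    obtain ⟨j, hj, hstep⟩ := hyx
    refine ⟨hpos, _, ⟨j, hj, rfl⟩, ?_⟩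
    rw [List.get_eq_getElem, List.get_eq_getElem, Option.some.inj hhead, Option.some.inj hlast,
      hstep]

theorem IsPushPath.isAuxCode_get (h : IsPushPath x y l) (hyx : PushStep y x)
    (haux : ∀ q ≠ pos n n, ∀ σ ∈ l, swap q (pos n n) * σ ∉ l) : IsAuxCode l.get where
  pushToTop := h.isPushToTopCode_get hyx
  aux q hq σ hσ hτ := by
    rw [Set.range_list_get] at hσ hτ
    rw [top_eq_pos_self] at hq hτ
    exact haux q hq.ne σ hσ hτ

theorem startsWith_get (l : List (Perm (Fin (n + 1)))) :
    StartsWith (1 :: top n n :: l).get 1 (pushToTop ⊤) := by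
  refine ⟨by simp, rfl, ?_⟩
  rw [pushToTop, top_eq_pos_self, pushToIndex, one_mul]
  rfl

theorem exists_auxCode (hn : 7 ≤ n) (hodd : Odd n) :
    ∃ M : ℕ, (∃ c : Fin M → Perm (Fin (n + 1)), IsAuxCode c ∧ StartsWith c 1 (pushToTop ⊤)) ∧
      2 * M + 2 = (n - 1) * (4 + n * ((n - 2) * (n - 2).factorial)) := by
  obtain ⟨l, hl, hlen, hmem⟩ := exists_code_path hn hodd
  refine ⟨_, ⟨_, hl.isAuxCode_get ?_ fun q hq σ hσ =>
    swap_mul_notMem (by lia) hodd hmem hq hσ, startsWith_get _⟩, ?_⟩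
  · rw [← classStart_self_mul_shift (by lia) hodd]
    exact pushStep_mul_top (by lia) (by lia) _
  · rw [← hlen]
    simp only [List.length_cons, List.length_append, List.length_nil]
    ring

theorem cast_auxCode_size {M : ℕ} (hn : 2 ≤ n)
    (hM : 2 * M + 2 = (n - 1) * (4 + n * ((n - 2) * (n - 2).factorial))) :
    (M : ℚ) = ((n : ℚ) - 2) * ((n.factorial : ℚ) / 2 + 2) + 1 := by
  obtain ⟨m, rfl⟩ := Nat.exists_eq_add_of_le' hn
  rw [show m + 2 - 1 = m + 1 from rfl, Nat.add_sub_cancel] at hM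
  have hM : (2 : ℚ) * M + 2 = (m + 1) * (4 + (m + 2) * (m * m.factorial)) := by exact_mod_cast hM
  rw [Nat.factorial_succ, Nat.factorial_succ]
  push_cast
  linarith

theorem lt_auxCode_size {k : ℕ} {M : ℚ} (hk : 3 ≤ k)
    (hM : M = ((k : ℚ) - 3) * (((k - 1).factorial : ℚ) / 2 + 2) + 1) :
    M > ((k : ℚ) - 3) / k * ((k.factorial : ℚ) / 2) := by
  obtain ⟨n, rfl⟩ := Nat.exists_eq_add_of_le' (by lia : 1 ≤ k)
  rw [hM, Nat.factorial_succ, Nat.add_sub_cancel]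
  have hn : (3 : ℚ) ≤ n + 1 := by exact_mod_cast hk
  push_cast
  rw [show ((n : ℚ) + 1 - 3) / (n + 1) * ((n + 1) * n.factorial / 2) =
    (n + 1 - 3) * (n.factorial / 2) by field_simp]
  linarith

end IsAuxCode

section SixLetters

variable {n j : ℕ}

/-- The vector notation of a permutation, with the letters numbered from `0`. -/
def toVec (σ : Perm (Fin (n + 1))) : List ℕ := List.ofFn fun p => (σ p).val

theorem length_toVec (σ : Perm (Fin (n + 1))) : (toVec σ).length = n + 1 := List.length_ofFn

theorem toVec_injective : Function.Injective (toVec (n := n)) := fun _ _ h =>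
  Perm.ext fun p => Fin.ext (congrFun (List.ofFn_injective h) p)

/-- The transition on the index `j`, in vector notation. -/
def pushVec (j : ℕ) (a : List ℕ) : List ℕ := a.getD j 0 :: a.eraseIdx j

theorem toVec_mul_top (hj : j ≤ n) (σ : Perm (Fin (n + 1))) :
    toVec (σ * top n j) = pushVec j (toVec σ) := by
  have hlen := length_toVec σ
  refine List.ext_getElem ?_ fun i hi hi' => ?_
  · rw [pushVec, List.length_cons, List.length_eraseIdx_of_lt (by lia), length_toVec,
      length_toVec]
    lia
  · rw [length_toVec] at hi
    have entry : ∀ k (hk : k < n + 1), (top n j ⟨i, hi⟩).val = k →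
        (toVec (σ * top n j))[i] = (toVec σ)[k] := fun k hk h => by
      simp only [toVec, List.getElem_ofFn, Perm.mul_apply]
      exact congrArg (fun p => (σ p).val) (Fin.ext h)
    have htop := top_val hj ⟨i, hi⟩
    rcases i with _ | i
    · rw [entry j (by lia) (htop.trans (if_pos rfl))]
      simp only [pushVec, List.getElem_cons_zero]
      rw [List.getD_eq_getElem _ _ (by lia)]
    · simp only [pushVec, List.getElem_cons_succ, List.getElem_eraseIdx]
      split_ifs with h
      · exact entry i (by lia) (by rw [htop]; split_ifs <;> lia)
      · exact entry (i + 1) (by lia) (by rw [htop]; split_ifs <;> lia)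

theorem map_toVec_scanl {js : List ℕ} (h : ∀ j ∈ js, j ≤ n) (σ : Perm (Fin (n + 1))) :
    (js.scanl (fun σ j => σ * top n j) σ).map toVec =
      js.scanl (fun a j => pushVec j a) (toVec σ) := by
  induction js generalizing σ with
  | nil => rfl
  | cons j js ih =>
    rw [List.forall_mem_cons] at h
    rw [List.scanl_cons, List.map_cons, ih h.2, toVec_mul_top h.1, List.scanl_cons]

theorem toVec_foldl {js : List ℕ} (h : ∀ j ∈ js, j ≤ n) (σ : Perm (Fin (n + 1))) :
    toVec (js.foldl (fun σ j => σ * top n j) σ) = js.foldl (fun a j => pushVec j a) (toVec σ) := by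
  have hlast := congrArg List.getLast? (map_toVec_scanl h σ)
  rwa [List.getLast?_map, List.getLast?_scanl, List.getLast?_scanl, Option.map_some,
    Option.some_inj] at hlast

/-- The base `m + 1` code of a vector in which the letters `q` and `m` are identified. -/
def mergedCode (q m : ℕ) (a : List ℕ) : ℕ :=
  Nat.ofDigits (m + 1) (a.map fun z => if z = q then m else z)

theorem mergedCode_toVec_swap_mul (q : Fin (n + 1)) (σ : Perm (Fin (n + 1))) :
    mergedCode q n (toVec (swap q (pos n n) * σ)) = mergedCode q n (toVec σ) := by
  rw [mergedCode, mergedCode, toVec, toVec, List.map_ofFn, List.map_ofFn]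
  congr 2
  funext p
  simp only [Function.comp_apply, Perm.mul_apply, swap_apply_def, Fin.ext_iff, pos_val le_rfl]
  split_ifs <;> simp_all [pos_val le_rfl]

theorem swap_mul_notMem_of_nodup {q : Fin (n + 1)} (hq : q ≠ pos n n)
    {l : List (Perm (Fin (n + 1)))} (h : (l.map (mergedCode q n ∘ toVec)).Nodup)
    {σ : Perm (Fin (n + 1))} (hσ : σ ∈ l) : swap q (pos n n) * σ ∉ l := fun hσ' =>
  hq (swap_eq_one_iff.1 (mul_eq_right.1
    (List.inj_on_of_nodup_map h hσ' hσ (mergedCode_toVec_swap_mul q σ))))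

/-- The indices of the successive transitions of the code in the symmetric group on six letters,
except for the one which closes the cycle. -/
def sixWord : List ℕ :=
  [5, 2, 4, 2, 4, 2, 2, 4, 2, 2, 4, 4, 4, 2, 2, 4, 2, 2, 4, 2, 4, 4, 2, 2, 4, 4, 4, 4, 2, 2, 4,
   4, 2, 2, 4, 4, 4, 2, 4, 4, 4, 2, 5, 2, 4, 2, 2, 4, 4, 2, 2, 4, 4, 2, 2, 4, 2, 2, 4, 2, 4, 4,
   2, 2, 4, 4, 4, 2, 4, 2, 2, 4, 2, 4, 2, 4, 2, 4, 4, 4, 2, 5, 2, 4, 4, 4, 4, 2, 2, 4, 4, 4, 2,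
   4, 4, 4, 2, 4, 2, 2, 4, 4, 2, 2, 4, 4, 2, 4, 2, 2, 4, 2, 4, 2, 2, 4, 2, 2, 4, 4, 4, 2, 2, 4,
   2, 4, 4, 4, 2, 5, 4, 5, 2, 4, 2, 4, 4, 2, 2, 4, 4, 2, 4, 2, 4, 4, 4, 4, 2, 2, 4, 2, 4, 2, 4,
   4, 4, 2, 2, 4, 4, 4, 4, 2, 2, 4, 4, 4, 2, 4, 2, 4, 2, 2, 4, 2, 5]

/-- The code in the symmetric group on six letters. -/
def sixCode : List (Perm (Fin 6)) := sixWord.scanl (fun σ j => σ * top 5 j) 1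

theorem mem_sixWord_bounds : ∀ j ∈ sixWord, 0 < j ∧ j ≤ 5 := by decide +kernel

set_option maxRecDepth 100000 in
theorem nodup_mergedCode_pushVec_sixWord : ∀ q < 5,
    ((sixWord.scanl (fun a j => pushVec j a) (toVec (1 : Perm (Fin 6)))).map
      (mergedCode q 5)).Nodup := by
  decide +kernel

set_option maxRecDepth 100000 in
theorem pushVec_foldl_sixWord :
    (sixWord ++ [4]).foldl (fun a j => pushVec j a) (toVec (1 : Perm (Fin 6))) =
      toVec (1 : Perm (Fin 6)) := by
  decide +kernel

theorem nodup_map_mergedCode_sixCode {q : ℕ} (hq : q < 5) :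
    (sixCode.map (mergedCode q 5 ∘ toVec)).Nodup := by
  rw [← List.map_map, sixCode, map_toVec_scanl fun j hj => (mem_sixWord_bounds j hj).2]
  exact nodup_mergedCode_pushVec_sixWord q hq

theorem isPushPath_sixCode :
    IsPushPath 1 (sixWord.foldl (fun σ j => σ * top 5 j) 1) sixCode where
  chain := isChain_scanl_top mem_sixWord_bounds 1
  nodup := .of_map _ (nodup_map_mergedCode_sixCode (by lia : 0 < 5))
  head := List.head?_scanl
  last := List.getLast?_scanl

theorem pushStep_foldl_sixWord_one : PushStep (sixWord.foldl (fun σ j => σ * top 5 j) 1) 1 := by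
  have hle : ∀ j ∈ sixWord ++ [4], j ≤ 5 :=
    List.forall_mem_append.2 ⟨fun j hj => (mem_sixWord_bounds j hj).2, by decide⟩
  have hclose : (sixWord ++ [4]).foldl (fun σ j => σ * top 5 j) 1 = 1 :=
    toVec_injective ((toVec_foldl hle 1).trans pushVec_foldl_sixWord)
  rw [List.foldl_append] at hclose
  exact ⟨4, by lia, hclose.symm⟩

theorem isAuxCode_sixCode_get : IsAuxCode sixCode.get :=
  isPushPath_sixCode.isAuxCode_get pushStep_foldl_sixWord_one fun q hq _ hσ =>
    swap_mul_notMem_of_nodup hq (nodup_map_mergedCode_sixCode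
      (lt_of_le_of_ne (Nat.le_of_lt_succ q.isLt) fun h => hq (Fin.ext h))) hσ

theorem exists_auxCode_six :
    ∃ c : Fin 178 → Perm (Fin 6), IsAuxCode c ∧ StartsWith c 1 (pushToTop ⊤) := by
  have hlen : sixCode.length = 178 := List.length_scanl
  have hstart : ∃ t, sixCode = 1 :: top 5 5 :: t := ⟨_, rfl⟩
  obtain ⟨t, ht⟩ := hstart
  rw [← hlen]
  exact ⟨_, isAuxCode_sixCode_get, ht ▸ startsWith_get t⟩

end SixLetters

end PushCode

theorem mainTheorem3 (k : ℕ) [NeZero k] (hk : 6 ≤ k) (hk_even : Even k) :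
    ∃ M : ℕ,
      (∃ c : Fin M → Equiv.Perm (Fin k), IsAuxCode c ∧ StartsWith c 1 (pushToTop ⊤)) ∧
      (M : ℚ) = (if k = 6 then 178 else
        ((k : ℚ) - 3) * (((k - 1).factorial : ℚ) / 2 + 2) + 1) ∧
      (6 < k → (M : ℚ) > ((k : ℚ) - 3) / k * ((k.factorial : ℚ) / 2)) := by
  rcases hk.eq_or_lt with rfl | hk
  · obtain ⟨c, hc⟩ := PushCode.exists_auxCode_six
    exact ⟨178, ⟨c, hc⟩, by norm_num, fun h => absurd h (lt_irrefl _)⟩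
  · obtain ⟨n, rfl⟩ : ∃ n, k = n + 1 := ⟨k - 1, by lia⟩
    have hodd : Odd n := by
      rwa [Nat.even_add_one, Nat.not_even_iff_odd] at hk_even
    have hn : 7 ≤ n := by
      obtain ⟨r, rfl⟩ := hodd
      lia
    obtain ⟨M, hc, hM⟩ := PushCode.exists_auxCode hn hodd
    have hsize : (M : ℚ) =
        (((n + 1 : ℕ) : ℚ) - 3) * (((n + 1 - 1).factorial : ℚ) / 2 + 2) + 1 := by
      rw [PushCode.cast_auxCode_size (by lia) hM, Nat.add_sub_cancel]
      push_cast
      ring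
    exact ⟨M, hc, by rw [hsize, if_neg (by lia)], fun _ => PushCode.lt_auxCode_size (by lia) hsize⟩
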